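/- Let $\ell\neq 0$ be real, and let $\Delta$ be the closed equilateral triangle with vertices $v_0=(\ell,0)$, $v_1=(-\tfrac{\ell}{2},\tfrac{\sqrt3\,\ell}{2})$ and $v_2=(-\tfrac{\ell}{2},-\tfrac{\sqrt3\,\ell}{2})$. A real function $f$ on $\Delta$ is called a Dirichlet solution with scalar $\kappa$ if it is continuous on $\Delta$, is $C^2$ in the interior of $\Delta$, satisfies $\nabla^2 f+\kappa f=0$ there, and vanishes on $\partial\Delta$. Let $\sigma$ be the counter-clockwise rotation by $120^\circ$ about the origin and $\mu$ the reflection in the $x$-axis; they act on functions on $\Delta$ by $(\alpha f)(p)=f(\alpha^{-1}p)$. A Dirichlet solution $f$ is in class A1 if $\sigma f=f$ and $\mu f=f$, in class A2 if $\sigma f=f$ and $\mu f=-f$, and in class E2 if $\sigma f\neq\pm f$ and $\mu f=-f$. Let $k$ be real and let $f$ be a Dirichlet solution on $\Delta$ with scalar $k^2$. Then there is exactly one function $F:\mathbb R^2\to\mathbb R$ which agrees with $f$ on $\Delta$ and satisfies $F\circ r_i=-F$ for the reflections $r_0,r_1,r_2$ of the plane in the three side lines of $\Delta$. This tessellation $F$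 is smooth and satisfies $\nabla^2F+k^2F=0$ on the whole plane. For every integer $n\ge 1$ put $$D_n(x,y)=\bigl(nx+(1-n)\ell,\;ny\bigr),\qquad f_n=F\circ D_n .$$ Then: 1. $f_n$ is a Dirichlet solution on $\Delta$ with scalar $n^2k^2$, and $f_n$ is not identically zero on $\Delta$ if $f$ is not. 2. $\Delta$ is the union of $n^2$ equilateral triangles $T_1,\dots,T_{n^2}$ with pairwise disjoint interiors, such that for each $j$ there is a composition $w_j$ of finitely many, say $m_j$, of the reflections $r_0,r_1,r_2$ with $D_n(T_j)=w_j(\Delta)$ and $f_n\bigl(D_n^{-1}(w_j\,p)\bigr)=(-1)^{m_j}f(p)$ for all $p\in\Delta$. In particular each $T_j$ is congruent to $\tfrac1n\Delta$. 3. If $\sigma f=f$ on $\Delta$, then $\sigma f_n=f_n$ on $\Delta$. If $f$ is in class A1, then so is $f_n$; if $f$ is in class A2, then so is $f_n$. 4. If $f$ is in class E2, then $f_n$ is in class A2 if and only if $3$ divides $n$. -/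

import Mathlib

open scoped ContDiff

noncomputable section

namespace TriangleHelmholtz

/-- The Euclidean plane. -/
abbrev Plane := EuclideanSpace ℝ (Fin 2)

/-- The counter-clockwise rotation by `120°` about the origin. -/
def sigma (p : Plane) : Plane :=
  !₂[(-p 0 - √3 * p 1) / 2, (√3 * p 0 - p 1) / 2]

/-- The inverse of `sigma`. -/
def sigmaInv (p : Plane) : Plane :=
  !₂[(-p 0 + √3 * p 1) / 2, (-(√3 * p 0) - p 1) / 2]

theorem sigma_sigmaInv (p : Plane) : sigma (sigmaInv p) = p := by
  have h : √3 * √3 = (3 : ℝ) := Real.mul_self_sqrt (by norm_num)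
  ext i
  fin_cases i
  · simp [sigma, sigmaInv]; linear_combination (p 0 / 4) * h
  · simp [sigma, sigmaInv]; linear_combination (p 1 / 4) * h

theorem sigmaInv_sigma (p : Plane) : sigmaInv (sigma p) = p := by
  have h : √3 * √3 = (3 : ℝ) := Real.mul_self_sqrt (by norm_num)
  ext i
  fin_cases i
  · simp [sigma, sigmaInv]; linear_combination (p 0 / 4) * h
  · simp [sigma, sigmaInv]; linear_combination (p 1 / 4) * h

/-- The reflection in the `x`-axis; it is its own inverse. -/
def mu (p : Plane) : Plane := !₂[p 0, -p 1]

/-- The vertices `(ℓ, 0)`, `(-ℓ/2, √3 ℓ/2)`, `(-ℓ/2, -√3 ℓ/2)`. -/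
def vertex (ℓ : ℝ) : Fin 3 → Plane :=
  ![!₂[ℓ, 0], !₂[-ℓ / 2, √3 * ℓ / 2], !₂[-ℓ / 2, -(√3 * ℓ / 2)]]

/-- The closed equilateral triangle centred at the origin with one vertex at `(ℓ, 0)`. -/
def triangle (ℓ : ℝ) : Set Plane := convexHull ℝ (Set.range (vertex ℓ))

/-- The line through the two vertices other than vertex `i`. -/
def sideLine (ℓ : ℝ) (i : Fin 3) : AffineSubspace ℝ Plane :=
  line[ℝ, vertex ℓ (i + 1), vertex ℓ (i + 2)]

instance (ℓ : ℝ) (i : Fin 3) : Nonempty (sideLine ℓ i) :=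
  ⟨⟨vertex ℓ (i + 1), left_mem_affineSpan_pair ℝ _ _⟩⟩

/-- The reflection of the plane in the side line opposite to vertex `i`. -/
def sideReflection (ℓ : ℝ) (i : Fin 3) (p : Plane) : Plane :=
  EuclideanGeometry.reflection (sideLine ℓ i) p

/-- `f` (only its values on the closed triangle matter) is a classical solution of
`∇² f + κ f = 0` in the open triangle which is continuous on the closed triangle and vanishes
on the boundary. -/
structure IsDirichletSolution (ℓ κ : ℝ) (f : Plane → ℝ) : Prop where
  contDiffOn : ContDiffOn ℝ 2 f (interior (triangle ℓ))
  continuousOn : ContinuousOn f (triangle ℓ)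
  boundary : ∀ p ∈ frontier (triangle ℓ), f p = 0
  helmholtz : ∀ p ∈ interior (triangle ℓ), Laplacian.laplacian f p + κ * f p = 0

/-- The function `f` is not identically zero on the triangle. -/
def Nontriv (ℓ : ℝ) (f : Plane → ℝ) : Prop := ∃ p ∈ triangle ℓ, f p ≠ 0

/-- The rotated function `σ f`, that is `(σ f)(p) = f (σ⁻¹ p)`. -/
def rotate (f : Plane → ℝ) : Plane → ℝ := fun p => f (sigmaInv p)

/-- The reflected function `μ f`, that is `(μ f)(p) = f (μ⁻¹ p)`, where `μ⁻¹ = μ`. -/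
def reflect (f : Plane → ℝ) : Plane → ℝ := fun p => f (mu p)

/-- `σ f = f` on the triangle. -/
def RotSymmetric (ℓ : ℝ) (f : Plane → ℝ) : Prop :=
  Set.EqOn (rotate f) f (triangle ℓ)

/-- `σ f ≠ f` and `σ f ≠ -f` as functions on the triangle. -/
def RotAsymmetric (ℓ : ℝ) (f : Plane → ℝ) : Prop :=
  ¬ Set.EqOn (rotate f) f (triangle ℓ) ∧ ¬ Set.EqOn (rotate f) (-f) (triangle ℓ)

/-- `μ f = f` on the triangle. -/
def ReflSymmetric (ℓ : ℝ) (f : Plane → ℝ) : Prop :=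
  Set.EqOn (reflect f) f (triangle ℓ)

/-- `μ f = -f` on the triangle. -/
def ReflAntisymmetric (ℓ : ℝ) (f : Plane → ℝ) : Prop :=
  Set.EqOn (reflect f) (-f) (triangle ℓ)

/-- The symmetry class A1 of solutions with scalar `κ`. -/
def ClassA1 (ℓ κ : ℝ) (f : Plane → ℝ) : Prop :=
  IsDirichletSolution ℓ κ f ∧ RotSymmetric ℓ f ∧ ReflSymmetric ℓ f

/-- The symmetry class A2 of solutions with scalar `κ`. -/
def ClassA2 (ℓ κ : ℝ) (f : Plane → ℝ) : Prop :=
  IsDirichletSolution ℓ κ f ∧ RotSymmetric ℓ f ∧ ReflAntisymmetric ℓ f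

/-- The symmetry class E2 of solutions with scalar `κ`. -/
def ClassE2 (ℓ κ : ℝ) (f : Plane → ℝ) : Prop :=
  IsDirichletSolution ℓ κ f ∧ RotAsymmetric ℓ f ∧ ReflAntisymmetric ℓ f

/-- `F` tessellates the plane with `f` by reflection: it agrees with `f` on the closed triangle
and changes sign under the reflection in each of the three side lines. -/
def IsTessellation (ℓ : ℝ) (f F : Plane → ℝ) : Prop :=
  Set.EqOn F f (triangle ℓ) ∧ ∀ i p, F (sideReflection ℓ i p) = -F p

/-- The dilation by the factor `n` followed by a translation along the `x`-axis,
`(x, y) ↦ (n x + C, n y)`. With `C = (1 - n) ℓ` it fixes the vertex `(ℓ, 0)`, so that it maps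
one of the sub-triangles onto the triangle. -/
def dilation (ℓ : ℝ) (n : ℕ) (p : Plane) : Plane :=
  !₂[n * p 0 + (1 - n) * ℓ, n * p 1]

/-- The `n`-th harmonic, built from the tessellation `F` of the plane. -/
def harmonic (ℓ : ℝ) (n : ℕ) (F : Plane → ℝ) : Plane → ℝ := fun p => F (dilation ℓ n p)

/-- The composition of the side reflections listed in `w`. -/
def composeReflections (ℓ : ℝ) (w : List (Fin 3)) (p : Plane) : Plane :=
  w.foldr (sideReflection ℓ) p

/-- The triangle which the dilation maps onto the image of the original triangle under
the successive side reflections `w`. For `1 ≤ n` it is an equilateral triangle, scaled by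
`1 / n`. -/
def subTriangle (ℓ : ℝ) (n : ℕ) (w : List (Fin 3)) : Set Plane :=
  dilation ℓ n ⁻¹' (composeReflections ℓ w '' triangle ℓ)

/-- The words `W j` of side reflections decompose the triangle into `n²` sub-triangles which do
not overlap, and on each of them `g` is a scaled and reflected copy of `f`, with a change of
sign for every reflection. -/
structure IsReflectedDecomposition (ℓ : ℝ) (n : ℕ) (f g : Plane → ℝ)
    (W : Fin (n ^ 2) → List (Fin 3)) : Prop where
  union : ⋃ j, subTriangle ℓ n (W j) = triangle ℓ
  disjoint : Pairwise fun i j =>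
    Disjoint (interior (subTriangle ℓ n (W i))) (interior (subTriangle ℓ n (W j)))
  copy : ∀ j, ∀ p ∈ triangle ℓ, ∀ q, dilation ℓ n q = composeReflections ℓ (W j) p →
    g q = (-1) ^ (W j).length * f p

end TriangleHelmholtz

end

/-!
The existence of a smooth tessellation is a regularity statement, and it is obtained from a
completeness theorem: every Dirichlet solution on the triangle is a finite combination of explicit
trigonometric functions, which are odd under the three side reflections and solve the equation on
the whole plane.

Three affine functions `phase ℓ i`, with sum zero, are permuted by the side reflections up to
multiples of `2π`, so the alternating sums `eigenfun ℓ m n φ` of cosines of their integer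
combinations are odd. They are Helmholtz solutions with scalar `eigenval ℓ m n`, a positive definite
quadratic form in `(m, n)`. Three facts give the completeness theorem
`IsDirichletSolution.exists_isOdd_isHelmholtz`.

* A Dirichlet solution `f` with scalar `κ` is orthogonal to all eigenfunctions with another
  eigenvalue (`IsDirichletSolution.integral_mul_eq_zero`). In Green's identity for `p ↦ f (t p)`,
  `t < 1`, and an eigenfunction, only the boundary values of the former enter
  (`abs_integral_green_le`), and these tend to zero for `t → 1`.
* The eigenfunctions with eigenvalue `κ` span a finite-dimensional space, so `f` can be made
  orthogonal to them by subtracting one of their combinations.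
* A continuous function on the triangle that is orthogonal to all eigenfunctions is zero
  (`eq_zero_of_forall_integral_mul_eigenfunOn`). The span of the eigenfunctions is stable under
  multiplication by the real and imaginary part of the sum of the three exponentials
  `exp (i A) + exp (i B) + exp (i C)` of the phases. This sum separates the points of the triangle,
  and one eigenfunction has no zero in the interior, so the Stone–Weierstrass theorem applies.

Uniqueness holds since compositions of side reflections move every point of the plane into the
triangle (`exists_composeReflections_eq`): a reflection in a side line that separates the point from
the triangle lowers the number of separating lines of the tiling. The same fact, applied to
centroids, shows that every triangle of the tiling is a reflected copy of the original one, which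
gives the decomposition into `n²` triangles.

In the barycentric coordinates `x = b₁`, `y = b₂` the dilation is `(x, y) ↦ (n x, n y)`. An odd
function is invariant under the rotation about vertex `0` and under the translations by `(1, 1)` and
`(0, 3)`. As rotations about the centre and about the vertex differ by a translation, the `n`-th
harmonic is rotationally symmetric exactly if the tessellation has the period `(0, n)`
(`IsOdd.rotSymmetric_harmonic_iff`). Together with the period `(0, 3)` this settles the symmetry
classes.
-/

noncomputable section

namespace TriangleHelmholtz

/-! ### Barycentric coordinates -/

/-- The barycentric coordinates of a point of the plane with respect to `vertex ℓ`; the side line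
opposite to vertex `i` is the zero set of coordinate `i`. -/
def bary (ℓ : ℝ) (i : Fin 3) (p : Plane) : ℝ :=
  ![(1 + 2 * p 0 / ℓ) / 3, (1 + (√3 * p 1 - p 0) / ℓ) / 3, (1 - (√3 * p 1 + p 0) / ℓ) / 3] i

/-- The point whose barycentric coordinates with index `1` and `2` are `x` and `y`. -/
def ofBary (ℓ x y : ℝ) : Plane := !₂[ℓ * (2 - 3 * x - 3 * y) / 2, √3 * ℓ * (x - y) / 2]

theorem bary_zero_apply (ℓ : ℝ) (p : Plane) : bary ℓ 0 p = (1 + 2 * p 0 / ℓ) / 3 := rfl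

theorem bary_one_apply (ℓ : ℝ) (p : Plane) : bary ℓ 1 p = (1 + (√3 * p 1 - p 0) / ℓ) / 3 := rfl

theorem bary_two_apply (ℓ : ℝ) (p : Plane) : bary ℓ 2 p = (1 - (√3 * p 1 + p 0) / ℓ) / 3 := rfl

theorem sqrt_three_mul_self : √3 * √3 = (3 : ℝ) := Real.mul_self_sqrt (by norm_num)

theorem bary_zero_eq (ℓ : ℝ) (p : Plane) : bary ℓ 0 p = 1 - bary ℓ 1 p - bary ℓ 2 p := by
  rw [bary_zero_apply, bary_one_apply, bary_two_apply]; ring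

theorem continuous_bary (ℓ : ℝ) (i : Fin 3) : Continuous (bary ℓ i) := by
  fin_cases i
  · change Continuous fun p : Plane => (1 + 2 * p 0 / ℓ) / 3
    fun_prop
  · change Continuous fun p : Plane => (1 + (√3 * p 1 - p 0) / ℓ) / 3
    fun_prop
  · change Continuous fun p : Plane => (1 - (√3 * p 1 + p 0) / ℓ) / 3
    fun_prop

theorem bary_smul_add (ℓ : ℝ) (i : Fin 3) (a b : ℝ) (hab : a + b = 1) (p q : Plane) :
    bary ℓ i (a • p + b • q) = a * bary ℓ i p + b * bary ℓ i q := by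
  obtain rfl : b = 1 - a := by linarith
  fin_cases i <;> simp [bary] <;> ring

theorem bary_smul (ℓ : ℝ) (i : Fin 3) (t : ℝ) (p : Plane) :
    bary ℓ i (t • p) = t * bary ℓ i p + (1 - t) / 3 := by
  fin_cases i <;> simp [bary] <;> ring

theorem bary_vertex {ℓ : ℝ} (hℓ : ℓ ≠ 0) (i j : Fin 3) :
    bary ℓ i (vertex ℓ j) = if i = j then 1 else 0 := by
  have h := sqrt_three_mul_self
  fin_cases i <;> fin_cases j <;> simp [bary, vertex] <;> field_simp <;> nlinarith

theorem bary_one_ofBary {ℓ : ℝ} (hℓ : ℓ ≠ 0) (x y : ℝ) : bary ℓ 1 (ofBary ℓ x y) = x := by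
  have h := sqrt_three_mul_self
  simp only [bary_one_apply, ofBary, Matrix.cons_val_zero, Matrix.cons_val_one]
  field_simp
  linear_combination (x - y) * h

theorem bary_two_ofBary {ℓ : ℝ} (hℓ : ℓ ≠ 0) (x y : ℝ) : bary ℓ 2 (ofBary ℓ x y) = y := by
  have h := sqrt_three_mul_self
  simp only [bary_two_apply, ofBary, Matrix.cons_val_zero, Matrix.cons_val_one]
  field_simp
  linear_combination (y - x) * h

theorem ofBary_bary {ℓ : ℝ} (hℓ : ℓ ≠ 0) (p : Plane) :
    ofBary ℓ (bary ℓ 1 p) (bary ℓ 2 p) = p := by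
  have h := sqrt_three_mul_self
  ext i
  fin_cases i
  · simp [ofBary, bary_one_apply, bary_two_apply]; field_simp; ring
  · simp [ofBary, bary_one_apply, bary_two_apply]; field_simp; linear_combination (2 * p 1) * h

theorem bary_ext {ℓ : ℝ} (hℓ : ℓ ≠ 0) {p q : Plane} (h1 : bary ℓ 1 p = bary ℓ 1 q)
    (h2 : bary ℓ 2 p = bary ℓ 2 q) : p = q := by
  rw [← ofBary_bary hℓ p, h1, h2, ofBary_bary hℓ]

theorem mem_triangle_iff {ℓ : ℝ} (hℓ : ℓ ≠ 0) {p : Plane} :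
    p ∈ triangle ℓ ↔ ∀ i, 0 ≤ bary ℓ i p := by
  constructor
  · intro hp i
    have hconv : Convex ℝ {q : Plane | 0 ≤ bary ℓ i q} := by
      intro q hq r hr a b ha hb hab
      simp only [Set.mem_ofPred_eq] at hq hr ⊢
      rw [bary_smul_add ℓ i a b hab]
      positivity
    refine convexHull_min ?_ hconv hp
    rintro _ ⟨j, rfl⟩
    simp only [Set.mem_ofPred_eq, bary_vertex hℓ]
    split_ifs <;> norm_num
  · intro hp
    have hsum : ∑ i, bary ℓ i p = 1 := by
      rw [Fin.sum_univ_three, bary_zero_eq]; ring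
    have hp' : p = ∑ i, bary ℓ i p • vertex ℓ i := by
      have h := sqrt_three_mul_self
      rw [Fin.sum_univ_three, bary_zero_apply, bary_one_apply, bary_two_apply]
      ext i
      fin_cases i
      · simp [vertex]; field_simp; ring
      · simp [vertex]; field_simp; linear_combination -2 * p 1 * h
    rw [hp']
    exact (convex_convexHull ℝ _).sum_mem (fun i _ => hp i) hsum
      fun i _ => subset_convexHull ℝ _ (Set.mem_range_self i)

theorem isCompact_triangle (ℓ : ℝ) : IsCompact (triangle ℓ) :=
  (Set.finite_range _).isCompact_convexHull ℝ

theorem convex_triangle (ℓ : ℝ) : Convex ℝ (triangle ℓ) := convex_convexHull ℝ _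

theorem isClosed_triangle (ℓ : ℝ) : IsClosed (triangle ℓ) := (isCompact_triangle ℓ).isClosed

theorem bary_add_smul_vertex {ℓ : ℝ} (hℓ : ℓ ≠ 0) (i j : Fin 3) (u : ℝ) (p : Plane) :
    bary ℓ i (p + u • vertex ℓ j) = bary ℓ i p + u * if i = j then 2 / 3 else -(1 / 3) := by
  have h := sqrt_three_mul_self
  fin_cases i <;> fin_cases j <;> simp [bary, vertex] <;> field_simp <;>
    first | linear_combination (0 : ℝ) * h | linear_combination (ℓ * u) * h |
      linear_combination (-ℓ * u) * h

theorem isOpenMap_bary {ℓ : ℝ} (hℓ : ℓ ≠ 0) (i : Fin 3) : IsOpenMap (bary ℓ i) := by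
  refine IsOpenMap.of_sections fun p => ?_
  refine ⟨fun s => p + (3 / 2 * (s - bary ℓ i p)) • vertex ℓ i, ?_, by simp, fun s => ?_⟩
  · exact Continuous.continuousAt (by fun_prop)
  · rw [bary_add_smul_vertex hℓ, if_pos rfl]; ring

theorem interior_triangle {ℓ : ℝ} (hℓ : ℓ ≠ 0) :
    interior (triangle ℓ) = {p | ∀ i, 0 < bary ℓ i p} := by
  apply Set.Subset.antisymm
  · intro p hp i
    have himage : bary ℓ i '' interior (triangle ℓ) ⊆ interior (Set.Ici 0) := by
      apply interior_maximal _ (isOpenMap_bary hℓ i _ isOpen_interior)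
      rintro _ ⟨q, hq, rfl⟩
      exact (mem_triangle_iff hℓ).1 (interior_subset hq) i
    rw [interior_Ici] at himage
    exact himage ⟨p, hp, rfl⟩
  · apply interior_maximal
    · exact fun p hp => (mem_triangle_iff hℓ).2 fun i => (hp i).le
    · simp only [Set.ofPred_forall]
      exact isOpen_iInter_of_finite fun i => isOpen_lt continuous_const (continuous_bary ℓ i)

theorem mem_frontier_triangle_iff {ℓ : ℝ} (hℓ : ℓ ≠ 0) {p : Plane} :
    p ∈ frontier (triangle ℓ) ↔ p ∈ triangle ℓ ∧ ∃ i, bary ℓ i p = 0 := by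
  rw [(isClosed_triangle ℓ).frontier_eq, interior_triangle hℓ, Set.mem_sdiff]
  refine and_congr_right fun hp => ?_
  rw [mem_triangle_iff hℓ] at hp
  simp only [Set.mem_ofPred_eq, not_forall, not_lt]
  exact exists_congr fun i => ⟨fun h => le_antisymm h (hp i), fun h => h.le⟩

theorem smul_mem_interior_triangle {ℓ : ℝ} (hℓ : ℓ ≠ 0) {p : Plane} (hp : p ∈ triangle ℓ)
    {t : ℝ} (ht0 : 0 ≤ t) (ht1 : t < 1) : t • p ∈ interior (triangle ℓ) := by
  rw [interior_triangle hℓ]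
  intro i
  have h := mul_nonneg ht0 ((mem_triangle_iff hℓ).1 hp i)
  rw [bary_smul]
  linarith

theorem triangle_subset_closure_interior {ℓ : ℝ} (hℓ : ℓ ≠ 0) :
    triangle ℓ ⊆ closure (interior (triangle ℓ)) := by
  have h0 : (0 : Plane) ∈ interior (triangle ℓ) := by
    rw [interior_triangle hℓ]
    intro i
    fin_cases i <;> simp [bary]
  rw [(convex_triangle ℓ).closure_interior_eq_closure_of_nonempty_interior ⟨0, h0⟩]
  exact subset_closure

/-! ### The reflections in barycentric coordinates -/

theorem sideReflection_eq {ℓ : ℝ} (hℓ : ℓ ≠ 0) (i : Fin 3) (p : Plane) :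
    sideReflection ℓ i p = p + (-3 * bary ℓ i p) • vertex ℓ i := by
  have h := sqrt_three_mul_self
  set q : Plane := p + (-(3 / 2) * bary ℓ i p) • vertex ℓ i with hq
  have hmem : q ∈ sideLine ℓ i := by
    have : q = AffineMap.lineMap (vertex ℓ (i + 1)) (vertex ℓ (i + 2)) (bary ℓ (i + 2) q) := by
      rw [hq, bary_add_smul_vertex hℓ, AffineMap.lineMap_apply]
      ext j
      fin_cases i <;> fin_cases j <;> simp [bary, vertex] <;> field_simp <;>
        first | linear_combination (0 : ℝ) * h | (ring_nf; norm_num [Real.sq_sqrt]; try ring)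
    rw [this]
    exact AffineMap.lineMap_mem_affineSpan_pair _ _ _
  have horth : (3 / 2 * bary ℓ i p) • vertex ℓ i ∈ (sideLine ℓ i).directionᗮ := by
    apply Submodule.smul_mem
    rw [sideLine, direction_affineSpan, vectorSpan_pair,
      Submodule.mem_orthogonal_singleton_iff_inner_right]
    fin_cases i <;> simp [vertex, PiLp.inner_apply, Fin.sum_univ_two] <;> nlinarith
  have hp : p = (3 / 2 * bary ℓ i p) • vertex ℓ i +ᵥ q := by
    rw [hq, vadd_eq_add]; module
  have hr := EuclideanGeometry.reflection_orthogonal_vadd hmem horth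
  rw [← hp] at hr
  rw [sideReflection, hr, hq, vadd_eq_add]
  module

theorem bary_sideReflection {ℓ : ℝ} (hℓ : ℓ ≠ 0) (i j : Fin 3) (p : Plane) :
    bary ℓ i (sideReflection ℓ j p) =
      bary ℓ i p + if i = j then -2 * bary ℓ j p else bary ℓ j p := by
  rw [sideReflection_eq hℓ, bary_add_smul_vertex hℓ]
  split_ifs <;> ring

theorem sideReflection_sideReflection {ℓ : ℝ} (i : Fin 3) (p : Plane) :
    sideReflection ℓ i (sideReflection ℓ i p) = p :=
  EuclideanGeometry.reflection_reflection _ p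

theorem sideReflection_eq_self {ℓ : ℝ} (hℓ : ℓ ≠ 0) {i : Fin 3} {p : Plane}
    (hp : bary ℓ i p = 0) : sideReflection ℓ i p = p := by
  simp [sideReflection_eq hℓ, hp]

/-! ### The other maps in barycentric coordinates -/

theorem bary_one_sigmaInv (ℓ : ℝ) (p : Plane) : bary ℓ 1 (sigmaInv p) = bary ℓ 2 p := by
  have h := sqrt_three_mul_self
  simp only [bary_one_apply, bary_two_apply, sigmaInv, Matrix.cons_val_zero, Matrix.cons_val_one]
  linear_combination (-p 0 / ℓ / 6) * h

theorem bary_two_sigmaInv (ℓ : ℝ) (p : Plane) : bary ℓ 2 (sigmaInv p) = bary ℓ 0 p := by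
  have h := sqrt_three_mul_self
  simp only [bary_zero_apply, bary_two_apply, sigmaInv, Matrix.cons_val_zero, Matrix.cons_val_one]
  linear_combination (p 0 / ℓ / 6) * h

theorem bary_mu (ℓ : ℝ) (p : Plane) :
    bary ℓ 1 (mu p) = bary ℓ 2 p ∧ bary ℓ 2 (mu p) = bary ℓ 1 p := by
  simp only [bary_one_apply, bary_two_apply, mu, Matrix.cons_val_zero, Matrix.cons_val_one]
  constructor <;> ring

theorem bary_dilation {ℓ : ℝ} (hℓ : ℓ ≠ 0) (n : ℕ) (p : Plane) :
    bary ℓ 1 (dilation ℓ n p) = n * bary ℓ 1 p ∧ bary ℓ 2 (dilation ℓ n p) = n * bary ℓ 2 p := by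
  simp only [bary_one_apply, bary_two_apply, dilation, Matrix.cons_val_zero, Matrix.cons_val_one]
  constructor <;> field_simp <;> ring

/-! ### Every point is a reflected point of the triangle -/

/-- The number of integers that separate `x` from the open unit interval. -/
def separationCount (x : ℝ) : ℕ := ⌈-x⌉₊ + ⌈x - 1⌉₊

theorem separationCount_one_sub (x : ℝ) : separationCount (1 - x) = separationCount x := by
  rw [separationCount, separationCount, add_comm]
  congr 2 <;> ring

theorem separationCount_neg_lt {x : ℝ} (hx : x < 0) :
    separationCount (-x) < separationCount x := by
  have h1 : ⌈- -x⌉₊ = 0 := Nat.ceil_eq_zero.2 (by linarith)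
  have h2 : ⌈x - 1⌉₊ = 0 := Nat.ceil_eq_zero.2 (by linarith)
  have h3 : 0 < ⌈-x⌉₊ := Nat.ceil_pos.2 (by linarith)
  rw [separationCount, separationCount, h1, h2, Nat.ceil_sub_one]
  omega

/-- Reflecting in a side line with the triangle on its other side lowers the number of lines of
the tiling that separate the point from the triangle. -/
theorem sum_separationCount_sideReflection_lt {ℓ : ℝ} (hℓ : ℓ ≠ 0) {i : Fin 3} {p : Plane}
    (hp : bary ℓ i p < 0) :
    ∑ j, separationCount (bary ℓ j (sideReflection ℓ i p)) <
      ∑ j, separationCount (bary ℓ j p) := by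
  have hlt := separationCount_neg_lt hp
  have h0 := separationCount_one_sub (bary ℓ 0 p)
  have h1 := separationCount_one_sub (bary ℓ 1 p)
  have h2 := separationCount_one_sub (bary ℓ 2 p)
  have hs := bary_zero_eq ℓ p
  simp only [Fin.sum_univ_three, bary_sideReflection hℓ]
  fin_cases i
  · have e0 : bary ℓ 0 p + -(2 * bary ℓ 0 p) = -bary ℓ 0 p := by ring
    have e1 : bary ℓ 1 p + bary ℓ 0 p = 1 - bary ℓ 2 p := by linarith
    have e2 : bary ℓ 2 p + bary ℓ 0 p = 1 - bary ℓ 1 p := by linarith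
    simp [e0, e1, e2] at hlt ⊢
    omega
  · have e0 : bary ℓ 0 p + bary ℓ 1 p = 1 - bary ℓ 2 p := by linarith
    have e1 : bary ℓ 1 p + -(2 * bary ℓ 1 p) = -bary ℓ 1 p := by ring
    have e2 : bary ℓ 2 p + bary ℓ 1 p = 1 - bary ℓ 0 p := by linarith
    simp [e0, e1, e2] at hlt ⊢
    omega
  · have e0 : bary ℓ 0 p + bary ℓ 2 p = 1 - bary ℓ 1 p := by linarith
    have e1 : bary ℓ 1 p + bary ℓ 2 p = 1 - bary ℓ 0 p := by linarith
    have e2 : bary ℓ 2 p + -(2 * bary ℓ 2 p) = -bary ℓ 2 p := by ring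
    simp [e0, e1, e2] at hlt ⊢
    omega

theorem exists_composeReflections_eq {ℓ : ℝ} (hℓ : ℓ ≠ 0) (p : Plane) :
    ∃ w, ∃ q ∈ triangle ℓ, composeReflections ℓ w q = p := by
  induction hN : ∑ j, separationCount (bary ℓ j p) using Nat.strong_induction_on generalizing p with
  | _ N ih =>
    by_cases hp : p ∈ triangle ℓ
    · exact ⟨[], p, hp, rfl⟩
    · rw [mem_triangle_iff hℓ] at hp
      push Not at hp
      obtain ⟨i, hi⟩ := hp
      obtain ⟨w, q, hq, hw⟩ :=
        ih _ (hN ▸ sum_separationCount_sideReflection_lt hℓ hi) (sideReflection ℓ i p) rfl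
      refine ⟨i :: w, q, hq, ?_⟩
      have : composeReflections ℓ (i :: w) q = sideReflection ℓ i (composeReflections ℓ w q) := rfl
      rw [this, hw, sideReflection_sideReflection]

/-! ### Functions that are odd under the side reflections -/

/-- `F` changes sign under the reflection in each of the three side lines. -/
def IsOdd (ℓ : ℝ) (F : Plane → ℝ) : Prop := ∀ i p, F (sideReflection ℓ i p) = -F p

theorem IsOdd.composeReflections {ℓ : ℝ} {F : Plane → ℝ} (hF : IsOdd ℓ F) (w : List (Fin 3))
    (p : Plane) : F (composeReflections ℓ w p) = (-1) ^ w.length * F p := by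
  induction w with
  | nil => simp [TriangleHelmholtz.composeReflections]
  | cons i w ih =>
    have : TriangleHelmholtz.composeReflections ℓ (i :: w) p =
      sideReflection ℓ i (TriangleHelmholtz.composeReflections ℓ w p) := rfl
    rw [this, hF, ih, List.length_cons, pow_succ]
    ring

theorem IsOdd.eq_of_eqOn {ℓ : ℝ} (hℓ : ℓ ≠ 0) {F G : Plane → ℝ} (hF : IsOdd ℓ F)
    (hG : IsOdd ℓ G) (h : Set.EqOn F G (triangle ℓ)) : F = G := by
  funext p
  obtain ⟨w, q, hq, rfl⟩ := exists_composeReflections_eq hℓ p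
  rw [hF.composeReflections, hG.composeReflections, h hq]

theorem IsOdd.eq_zero_of_bary_eq_zero {ℓ : ℝ} (hℓ : ℓ ≠ 0) {F : Plane → ℝ} (hF : IsOdd ℓ F)
    {i : Fin 3} {p : Plane} (hp : bary ℓ i p = 0) : F p = 0 := by
  have h := hF i p
  rw [sideReflection_eq_self hℓ hp] at h
  linarith

theorem sideReflection_ofBary {ℓ : ℝ} (hℓ : ℓ ≠ 0) (x y : ℝ) :
    sideReflection ℓ 0 (ofBary ℓ x y) = ofBary ℓ (1 - y) (1 - x) ∧
    sideReflection ℓ 1 (ofBary ℓ x y) = ofBary ℓ (-x) (x + y) ∧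
    sideReflection ℓ 2 (ofBary ℓ x y) = ofBary ℓ (x + y) (-y) := by
  refine ⟨?_, ?_, ?_⟩ <;> apply bary_ext hℓ <;>
    simp [bary_sideReflection hℓ, bary_zero_eq, bary_one_ofBary hℓ, bary_two_ofBary hℓ] <;> ring

/-- Oddness under the side reflections, in barycentric coordinates. -/
theorem isOdd_iff {ℓ : ℝ} (hℓ : ℓ ≠ 0) {F : Plane → ℝ} :
    IsOdd ℓ F ↔ (∀ x y, F (ofBary ℓ (1 - y) (1 - x)) = -F (ofBary ℓ x y)) ∧
      (∀ x y, F (ofBary ℓ (-x) (x + y)) = -F (ofBary ℓ x y)) ∧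
      (∀ x y, F (ofBary ℓ (x + y) (-y)) = -F (ofBary ℓ x y)) := by
  constructor
  · intro h
    refine ⟨fun x y => ?_, fun x y => ?_, fun x y => ?_⟩
    · rw [← (sideReflection_ofBary hℓ x y).1, h]
    · rw [← (sideReflection_ofBary hℓ x y).2.1, h]
    · rw [← (sideReflection_ofBary hℓ x y).2.2, h]
  · rintro ⟨h0, h1, h2⟩ i p
    rw [← ofBary_bary hℓ p]
    fin_cases i
    · exact (congrArg F (sideReflection_ofBary hℓ _ _).1).trans (h0 _ _)
    · exact (congrArg F (sideReflection_ofBary hℓ _ _).2.1).trans (h1 _ _)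
    · exact (congrArg F (sideReflection_ofBary hℓ _ _).2.2).trans (h2 _ _)

section Coordinates

variable {ℓ : ℝ} {F : Plane → ℝ}

/-- The rotation by `120°` about the vertex `0` is a composition of two side reflections. -/
theorem IsOdd.rotate_vertex (hℓ : ℓ ≠ 0) (hF : IsOdd ℓ F) (x y : ℝ) :
    F (ofBary ℓ y (-x - y)) = F (ofBary ℓ x y) := by
  obtain ⟨-, h1, h2⟩ := (isOdd_iff hℓ).1 hF
  have e2 := h1 (x + y) (-y)
  have e3 := h2 x y
  have e4 := h2 (-(x + y)) (x + y + -y)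
  have e5 := h1 (-(x + y) + (x + y + -y)) (-(x + y + -y))
  ring_nf at e2 e3 e4 e5 ⊢
  linarith

theorem IsOdd.neg_swap (hℓ : ℓ ≠ 0) (hF : IsOdd ℓ F) (x y : ℝ) :
    F (ofBary ℓ (-y) (-x)) = -F (ofBary ℓ x y) := by
  have h2 := ((isOdd_iff hℓ).1 hF).2.2
  have e1 := hF.rotate_vertex hℓ x y
  have e2 := h2 y (-x - y)
  have e3 := hF.rotate_vertex hℓ (-y) (-x)
  have e4 := hF.rotate_vertex hℓ (-x) (x + y)
  ring_nf at e1 e2 e3 e4 ⊢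
  linarith

theorem IsOdd.translate_one_one (hℓ : ℓ ≠ 0) (hF : IsOdd ℓ F) (x y : ℝ) :
    F (ofBary ℓ (x + 1) (y + 1)) = F (ofBary ℓ x y) := by
  have e1 := ((isOdd_iff hℓ).1 hF).1 (-y) (-x)
  have e2 := hF.neg_swap hℓ x y
  ring_nf at e1 e2 ⊢
  linarith

theorem IsOdd.translate_nat (hℓ : ℓ ≠ 0) (hF : IsOdd ℓ F) (n : ℕ) (x y : ℝ) :
    F (ofBary ℓ (x + n) (y + n)) = F (ofBary ℓ x y) := by
  induction n with
  | zero => simp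
  | succ n ih => rw [← ih, ← hF.translate_one_one hℓ (x + n)]; push_cast; ring_nf

theorem IsOdd.translate_zero_three (hℓ : ℓ ≠ 0) (hF : IsOdd ℓ F) (x y : ℝ) :
    F (ofBary ℓ x (y + 3)) = F (ofBary ℓ x y) := by
  have h1 := ((isOdd_iff hℓ).1 hF).2.1
  have e1 := h1 x y
  have e2 := hF.translate_one_one hℓ (-x) (x + y)
  have e3 := h1 (-x + 1) (x + y + 1)
  have e4 := hF.translate_one_one hℓ (x - 1) (y + 2)
  ring_nf at e1 e2 e3 e4 ⊢
  linarith

theorem IsOdd.translate_zero_mul_three (hℓ : ℓ ≠ 0) (hF : IsOdd ℓ F) (m : ℕ) (x y : ℝ) :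
    F (ofBary ℓ x (y + 3 * m)) = F (ofBary ℓ x y) := by
  induction m with
  | zero => simp
  | succ n ih => rw [← ih, ← hF.translate_zero_three hℓ x (y + 3 * n)]; push_cast; ring_nf

theorem translate_zero_mul {t : ℝ} (h : ∀ x y, F (ofBary ℓ x (y + t)) = F (ofBary ℓ x y)) (m : ℕ)
    (x y : ℝ) : F (ofBary ℓ x (y + m * t)) = F (ofBary ℓ x y) := by
  induction m with
  | zero => simp
  | succ n ih => rw [← ih, ← h x (y + n * t)]; push_cast; ring_nf


/-! ### Symmetries of the harmonics -/

theorem harmonic_ofBary (hℓ : ℓ ≠ 0) (n : ℕ) (x y : ℝ) :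
    harmonic ℓ n F (ofBary ℓ x y) = F (ofBary ℓ (n * x) (n * y)) := by
  refine congrArg F (bary_ext hℓ ?_ ?_) <;>
    simp [bary_dilation hℓ, bary_one_ofBary hℓ, bary_two_ofBary hℓ]

theorem rotate_ofBary (hℓ : ℓ ≠ 0) (x y : ℝ) :
    rotate F (ofBary ℓ x y) = F (ofBary ℓ y (1 - x - y)) := by
  refine congrArg F (bary_ext hℓ ?_ ?_) <;>
    simp [bary_one_sigmaInv, bary_two_sigmaInv, bary_zero_eq, bary_one_ofBary hℓ,
      bary_two_ofBary hℓ]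

theorem reflect_ofBary (hℓ : ℓ ≠ 0) (x y : ℝ) :
    reflect F (ofBary ℓ x y) = F (ofBary ℓ y x) := by
  refine congrArg F (bary_ext hℓ ?_ ?_) <;>
    simp [bary_mu, bary_one_ofBary hℓ, bary_two_ofBary hℓ]

theorem IsOdd.harmonic (hℓ : ℓ ≠ 0) (hF : IsOdd ℓ F) (n : ℕ) :
    IsOdd ℓ (TriangleHelmholtz.harmonic ℓ n F) := by
  obtain ⟨-, h1, h2⟩ := (isOdd_iff hℓ).1 hF
  refine (isOdd_iff hℓ).2 ⟨fun x y => ?_, fun x y => ?_, fun x y => ?_⟩ <;>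
    simp only [harmonic_ofBary hℓ]
  · have e1 := hF.translate_nat hℓ n (-(n * y)) (-(n * x))
    have e2 := hF.neg_swap hℓ (n * x) (n * y)
    ring_nf at e1 e2 ⊢
    linarith
  · have e1 := h1 (n * x) (n * y)
    ring_nf at e1 ⊢
    exact e1
  · have e1 := h2 (n * x) (n * y)
    ring_nf at e1 ⊢
    exact e1

theorem IsOdd.rotate (hℓ : ℓ ≠ 0) (hF : IsOdd ℓ F) : IsOdd ℓ (TriangleHelmholtz.rotate F) := by
  obtain ⟨h0, h1, h2⟩ := (isOdd_iff hℓ).1 hF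
  refine (isOdd_iff hℓ).2 ⟨fun x y => ?_, fun x y => ?_, fun x y => ?_⟩ <;>
    simp only [rotate_ofBary hℓ]
  · have e := h2 y (1 - x - y)
    ring_nf at e ⊢
    exact e
  · have e := h0 y (1 - x - y)
    ring_nf at e ⊢
    exact e
  · have e := h1 y (1 - x - y)
    ring_nf at e ⊢
    exact e

theorem IsOdd.reflect (hℓ : ℓ ≠ 0) (hF : IsOdd ℓ F) : IsOdd ℓ (TriangleHelmholtz.reflect F) := by
  obtain ⟨h0, h1, h2⟩ := (isOdd_iff hℓ).1 hF
  refine (isOdd_iff hℓ).2 ⟨fun x y => ?_, fun x y => ?_, fun x y => ?_⟩ <;>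
    simp only [reflect_ofBary hℓ]
  · exact h0 y x
  · rw [add_comm]; exact h2 y x
  · rw [add_comm]; exact h1 y x

theorem IsOdd.neg (hF : IsOdd ℓ F) : IsOdd ℓ (-F) := fun i p => by simp [hF i p]

theorem eq_iff_forall_ofBary (hℓ : ℓ ≠ 0) {G : Plane → ℝ} :
    F = G ↔ ∀ x y, F (ofBary ℓ x y) = G (ofBary ℓ x y) := by
  refine ⟨fun h x y => by rw [h], fun h => funext fun p => ?_⟩
  rw [← ofBary_bary hℓ p, h]

/-- After the dilation, the rotation about the centre becomes the rotation about vertex `0`, under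
which `F` is invariant, followed by the translation by `n` in a barycentric coordinate. -/
theorem IsOdd.rotSymmetric_harmonic_iff (hℓ : ℓ ≠ 0) (hF : IsOdd ℓ F) {n : ℕ} (hn : 1 ≤ n) :
    RotSymmetric ℓ (TriangleHelmholtz.harmonic ℓ n F) ↔
      ∀ x y, F (ofBary ℓ x (y + n)) = F (ofBary ℓ x y) := by
  have hn0 : (n : ℝ) ≠ 0 := by positivity
  have hH := hF.harmonic hℓ n
  have hR : RotSymmetric ℓ (TriangleHelmholtz.harmonic ℓ n F) ↔
      TriangleHelmholtz.rotate (TriangleHelmholtz.harmonic ℓ n F) =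
        TriangleHelmholtz.harmonic ℓ n F :=
    ⟨fun h => (hH.rotate hℓ).eq_of_eqOn hℓ hH h, fun h p _ => by rw [h]⟩
  rw [hR, eq_iff_forall_ofBary hℓ]
  simp only [rotate_ofBary hℓ, harmonic_ofBary hℓ]
  constructor
  · intro h x y
    have e1 := h ((-x - y) / n) (x / n)
    have e2 := hF.rotate_vertex hℓ (-x - y) x
    have a1 : (n : ℝ) * (x / n) = x := by field_simp
    have a2 : (n : ℝ) * ((-x - y) / n) = -x - y := by field_simp
    have a3 : (n : ℝ) * (1 - (-x - y) / n - x / n) = y + n := by field_simp; ring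
    have a4 : -(-x - y) - x = y := by ring
    rw [a1, a2, a3] at e1
    rw [a4] at e2
    rw [e1, e2]
  · intro h x y
    rw [← hF.rotate_vertex hℓ (n * x) (n * y), ← h (n * y) (-(n * x) - n * y)]
    congr 2
    ring

theorem harmonic_one : TriangleHelmholtz.harmonic ℓ 1 F = F := by
  funext p
  refine congrArg F ?_
  ext i
  fin_cases i <;> simp [dilation]

theorem IsOdd.rotSymmetric_iff (hℓ : ℓ ≠ 0) (hF : IsOdd ℓ F) :
    RotSymmetric ℓ F ↔ ∀ x y, F (ofBary ℓ x (y + 1)) = F (ofBary ℓ x y) := by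
  simpa [harmonic_one] using hF.rotSymmetric_harmonic_iff hℓ le_rfl

theorem IsOdd.rotSymmetric_harmonic (hℓ : ℓ ≠ 0) (hF : IsOdd ℓ F) {n : ℕ} (hn : 1 ≤ n)
    (h : RotSymmetric ℓ F) : RotSymmetric ℓ (TriangleHelmholtz.harmonic ℓ n F) := by
  rw [hF.rotSymmetric_iff hℓ] at h
  rw [hF.rotSymmetric_harmonic_iff hℓ hn]
  intro x y
  simpa using translate_zero_mul h n x y

theorem IsOdd.rotSymmetric_harmonic_iff_three_dvd (hℓ : ℓ ≠ 0) (hF : IsOdd ℓ F) {n : ℕ}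
    (hn : 1 ≤ n) (h : ¬ RotSymmetric ℓ F) :
    RotSymmetric ℓ (TriangleHelmholtz.harmonic ℓ n F) ↔ 3 ∣ n := by
  rw [hF.rotSymmetric_iff hℓ] at h
  rw [hF.rotSymmetric_harmonic_iff hℓ hn]
  constructor
  · -- The translations by `3` and by a non-multiple of `3` generate the translation by `1`.
    intro hper
    by_contra hdvd
    apply h
    intro x y
    have hmod : n % 3 = 1 ∨ n % 3 = 2 := by omega
    have hdiv : (n : ℝ) = 3 * (n / 3 : ℕ) + (n % 3 : ℕ) := by
      exact_mod_cast (Nat.div_add_mod n 3).symm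
    rcases hmod with hm | hm
    · have e1 := hper x y
      have e2 := hF.translate_zero_mul_three hℓ (n / 3) x (y + 1)
      rw [← e1, ← e2, hdiv, hm]
      congr 2
      push_cast
      ring
    · have e1 := hper x (y + 1)
      have e2 := hF.translate_zero_mul_three hℓ (n / 3 + 1) x y
      rw [← e1, ← e2, hdiv, hm]
      congr 2
      push_cast
      ring
  · rintro ⟨m, rfl⟩ x y
    simpa using hF.translate_zero_mul_three hℓ m x y

theorem IsOdd.reflSymmetric_harmonic (hℓ : ℓ ≠ 0) (hF : IsOdd ℓ F) (n : ℕ)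
    (h : ReflSymmetric ℓ F) : ReflSymmetric ℓ (TriangleHelmholtz.harmonic ℓ n F) := by
  have hF' := (eq_iff_forall_ofBary hℓ).1 ((hF.reflect hℓ).eq_of_eqOn hℓ hF h)
  refine fun p _ => congrFun ((eq_iff_forall_ofBary hℓ).2 fun x y => ?_) p
  rw [reflect_ofBary hℓ, harmonic_ofBary hℓ, harmonic_ofBary hℓ, ← hF', reflect_ofBary hℓ]

theorem IsOdd.reflAntisymmetric_harmonic (hℓ : ℓ ≠ 0) (hF : IsOdd ℓ F) (n : ℕ)
    (h : ReflAntisymmetric ℓ F) : ReflAntisymmetric ℓ (TriangleHelmholtz.harmonic ℓ n F) := by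
  have hF' := (eq_iff_forall_ofBary hℓ).1 ((hF.reflect hℓ).eq_of_eqOn hℓ hF.neg h)
  refine fun p _ => congrFun ((eq_iff_forall_ofBary hℓ).2 fun x y => ?_) p
  have e := hF' (n * x) (n * y)
  rw [reflect_ofBary hℓ] at e
  rw [reflect_ofBary hℓ, harmonic_ofBary hℓ, Pi.neg_apply, harmonic_ofBary hℓ, e, Pi.neg_apply]

end Coordinates

/-! ### Symmetries depend on the values on the triangle only -/

theorem sigmaInv_mem_triangle {ℓ : ℝ} (hℓ : ℓ ≠ 0) {p : Plane} (hp : p ∈ triangle ℓ) :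
    sigmaInv p ∈ triangle ℓ := by
  rw [mem_triangle_iff hℓ] at hp ⊢
  have h0 := bary_zero_eq ℓ (sigmaInv p)
  have h1 := bary_zero_eq ℓ p
  have hp1 := hp 1
  intro i
  fin_cases i
  · simp only [bary_one_sigmaInv, bary_two_sigmaInv] at h0
    simp
    linarith
  · simpa [bary_one_sigmaInv] using hp 2
  · simpa [bary_two_sigmaInv] using hp 0

theorem mu_mem_triangle {ℓ : ℝ} (hℓ : ℓ ≠ 0) {p : Plane} (hp : p ∈ triangle ℓ) :
    mu p ∈ triangle ℓ := by
  rw [mem_triangle_iff hℓ] at hp ⊢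
  have h0 := bary_zero_eq ℓ (mu p)
  have h1 := bary_zero_eq ℓ p
  have hp0 := hp 0
  intro i
  fin_cases i
  · rw [(bary_mu ℓ p).1, (bary_mu ℓ p).2] at h0
    simp
    linarith
  · simpa [bary_mu] using hp 2
  · simpa [bary_mu] using hp 1

theorem rotSymmetric_congr {ℓ : ℝ} (hℓ : ℓ ≠ 0) {f F : Plane → ℝ}
    (h : Set.EqOn F f (triangle ℓ)) : RotSymmetric ℓ F ↔ RotSymmetric ℓ f :=
  forall₂_congr fun p hp => by
    rw [rotate, rotate, h hp, h (sigmaInv_mem_triangle hℓ hp)]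

theorem reflSymmetric_congr {ℓ : ℝ} (hℓ : ℓ ≠ 0) {f F : Plane → ℝ}
    (h : Set.EqOn F f (triangle ℓ)) : ReflSymmetric ℓ F ↔ ReflSymmetric ℓ f :=
  forall₂_congr fun p hp => by
    rw [reflect, reflect, h hp, h (mu_mem_triangle hℓ hp)]

theorem reflAntisymmetric_congr {ℓ : ℝ} (hℓ : ℓ ≠ 0) {f F : Plane → ℝ}
    (h : Set.EqOn F f (triangle ℓ)) : ReflAntisymmetric ℓ F ↔ ReflAntisymmetric ℓ f :=
  forall₂_congr fun p hp => by
    rw [reflect, reflect, Pi.neg_apply, Pi.neg_apply, h hp, h (mu_mem_triangle hℓ hp)]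

/-! ### The tiling of the plane -/

/-- A triangle of the tiling of the plane by the lines on which a barycentric coordinate is an
integer: a translate of the original triangle for `e = 1`, and of its point reflection
for `e = -1`. -/
def cell (ℓ : ℝ) (e c d : ℤ) : Set Plane :=
  {p | 0 ≤ e * (bary ℓ 1 p - c) ∧ 0 ≤ e * (bary ℓ 2 p - d) ∧
    e * (bary ℓ 1 p + bary ℓ 2 p - c - d) ≤ 1}

theorem triangle_eq_cell {ℓ : ℝ} (hℓ : ℓ ≠ 0) : triangle ℓ = cell ℓ 1 0 0 := by
  ext p
  have h0 := bary_zero_eq ℓ p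
  rw [mem_triangle_iff hℓ, Fin.forall_fin_succ, Fin.forall_fin_two]
  simp only [cell, Set.mem_ofPred_eq, Fin.succ_zero_eq_one, Fin.succ_one_eq_two]
  push_cast
  constructor
  · rintro ⟨a, b, c⟩
    exact ⟨by linarith, by linarith, by linarith⟩
  · rintro ⟨a, b, c⟩
    exact ⟨by linarith, by linarith, by linarith⟩

theorem image_sideReflection {ℓ : ℝ} (i : Fin 3) (s : Set Plane) :
    sideReflection ℓ i '' s = sideReflection ℓ i ⁻¹' s :=
  congrFun (Set.image_eq_preimage_of_inverse (sideReflection_sideReflection i)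
    (sideReflection_sideReflection i)) s

theorem exists_image_cell_eq {ℓ : ℝ} (hℓ : ℓ ≠ 0) (i : Fin 3) {e : ℤ} (he : e = 1 ∨ e = -1)
    (c d : ℤ) : ∃ c' d', sideReflection ℓ i '' cell ℓ e c d = cell ℓ (-e) c' d' := by
  rw [image_sideReflection]
  have hmem : ∀ p, p ∈ sideReflection ℓ i ⁻¹' cell ℓ e c d ↔
    sideReflection ℓ i p ∈ cell ℓ e c d := fun p => Iff.rfl
  fin_cases i
  · refine ⟨1 - d, 1 - c, ?_⟩
    ext p
    have h0 := bary_zero_eq ℓ p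
    rw [hmem]
    rcases he with rfl | rfl <;>
      simp [cell, bary_sideReflection hℓ] <;> rw [h0] <;>
      constructor <;> rintro ⟨h1, h2, h3⟩ <;> refine ⟨?_, ?_, ?_⟩ <;> linarith
  · refine ⟨-c, c + d + e, ?_⟩
    ext p
    rw [hmem]
    rcases he with rfl | rfl <;>
      simp [cell, bary_sideReflection hℓ] <;>
      constructor <;> rintro ⟨h1, h2, h3⟩ <;> refine ⟨?_, ?_, ?_⟩ <;> linarith
  · refine ⟨c + d + e, -d, ?_⟩
    ext p
    rw [hmem]
    rcases he with rfl | rfl <;>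
      simp [cell, bary_sideReflection hℓ] <;>
      constructor <;> rintro ⟨h1, h2, h3⟩ <;> refine ⟨?_, ?_, ?_⟩ <;> linarith

theorem exists_composeReflections_image_eq_cell {ℓ : ℝ} (hℓ : ℓ ≠ 0) (w : List (Fin 3)) :
    ∃ e c d : ℤ, (e = 1 ∨ e = -1) ∧ composeReflections ℓ w '' triangle ℓ = cell ℓ e c d := by
  induction w with
  | nil => exact ⟨1, 0, 0, .inl rfl, by
      rw [← triangle_eq_cell hℓ]; exact Set.image_id _⟩
  | cons i w ih =>
    obtain ⟨e, c, d, he, h⟩ := ih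
    obtain ⟨c', d', h'⟩ := exists_image_cell_eq hℓ i he c d
    refine ⟨-e, c', d', by omega, ?_⟩
    rw [← h', ← h, ← Set.image_comp]
    rfl

/-- Every triangle of the tiling is an image of the original one: a composition of reflections
that moves its centroid into the original triangle does it. -/
theorem exists_composeReflections_image_eq {ℓ : ℝ} (hℓ : ℓ ≠ 0) {e : ℤ} (he : e = 1 ∨ e = -1)
    (c d : ℤ) : ∃ w, composeReflections ℓ w '' triangle ℓ = cell ℓ e c d := by
  obtain ⟨w, q, hq, hw⟩ := exists_composeReflections_eq hℓ (ofBary ℓ (c + e / 3) (d + e / 3))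
  obtain ⟨e', c', d', he', h⟩ := exists_composeReflections_image_eq_cell hℓ w
  refine ⟨w, h.trans ?_⟩
  have hmem : ofBary ℓ (c + e / 3) (d + e / 3) ∈ cell ℓ e' c' d' := h ▸ ⟨q, hq, hw⟩
  obtain ⟨h1, h2, h3⟩ := hmem
  rw [bary_one_ofBary hℓ] at h1 h3
  rw [bary_two_ofBary hℓ] at h2 h3
  -- Multiplied by three, the conditions on the centroid are linear inequalities of integers.
  have g1 : 0 ≤ e' * (3 * c + e - 3 * c') := by
    have : (0 : ℝ) ≤ e' * (3 * c + e - 3 * c') := by linarith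
    exact_mod_cast this
  have g2 : 0 ≤ e' * (3 * d + e - 3 * d') := by
    have : (0 : ℝ) ≤ e' * (3 * d + e - 3 * d') := by linarith
    exact_mod_cast this
  have g3 : e' * (3 * c + 3 * d + 2 * e - 3 * c' - 3 * d') ≤ 3 := by
    have : (e' * (3 * c + 3 * d + 2 * e - 3 * c' - 3 * d') : ℝ) ≤ 3 := by linarith
    exact_mod_cast this
  obtain ⟨rfl, rfl, rfl⟩ : e' = e ∧ c' = c ∧ d' = d := by
    rcases he with rfl | rfl <;> rcases he' with rfl | rfl <;> omega
  rfl

theorem bary_mem_interior {ℓ : ℝ} (hℓ : ℓ ≠ 0) (i : Fin 3) {s : Set Plane} {t : Set ℝ}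
    (hst : ∀ p ∈ s, bary ℓ i p ∈ t) {p : Plane} (hp : p ∈ interior s) :
    bary ℓ i p ∈ interior t := by
  refine interior_maximal ?_ (isOpenMap_bary hℓ i _ isOpen_interior) ⟨p, hp, rfl⟩
  rintro _ ⟨q, hq, rfl⟩
  exact hst q (interior_subset hq)

theorem interior_cell_subset {ℓ : ℝ} (hℓ : ℓ ≠ 0) {e : ℤ} (he : e = 1 ∨ e = -1) (c d : ℤ) :
    interior (cell ℓ e c d) ⊆ {p | 0 < e * (bary ℓ 1 p - c) ∧ 0 < e * (bary ℓ 2 p - d) ∧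
      e * (bary ℓ 1 p + bary ℓ 2 p - c - d) < 1} := by
  intro p hp
  have h0 := bary_zero_eq ℓ p
  rcases he with rfl | rfl
  · have g0 := bary_mem_interior hℓ 0 (t := Set.Ici (-c - d : ℝ)) (fun q hq => by
      have h := hq.2.2
      rw [Set.mem_Ici, bary_zero_eq]
      push_cast at h
      linarith) hp
    have g1 := bary_mem_interior hℓ 1 (t := Set.Ici (c : ℝ)) (fun q hq => by
      have h := hq.1
      rw [Set.mem_Ici]
      push_cast at h
      linarith) hp
    have g2 := bary_mem_interior hℓ 2 (t := Set.Ici (d : ℝ)) (fun q hq => by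
      have h := hq.2.1
      rw [Set.mem_Ici]
      push_cast at h
      linarith) hp
    rw [interior_Ici, Set.mem_Ioi] at g0 g1 g2
    refine ⟨?_, ?_, ?_⟩ <;> push_cast <;> linarith
  · have g0 := bary_mem_interior hℓ 0 (t := Set.Iic (2 - c - d : ℝ)) (fun q hq => by
      have h := hq.2.2
      rw [Set.mem_Iic, bary_zero_eq]
      push_cast at h
      linarith) hp
    have g1 := bary_mem_interior hℓ 1 (t := Set.Iic (c : ℝ)) (fun q hq => by
      have h := hq.1
      rw [Set.mem_Iic]
      push_cast at h
      linarith) hp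
    have g2 := bary_mem_interior hℓ 2 (t := Set.Iic (d : ℝ)) (fun q hq => by
      have h := hq.2.1
      rw [Set.mem_Iic]
      push_cast at h
      linarith) hp
    rw [interior_Iic, Set.mem_Iio] at g0 g1 g2
    refine ⟨?_, ?_, ?_⟩ <;> push_cast <;> linarith

theorem eq_of_mem_interior_cell {ℓ : ℝ} (hℓ : ℓ ≠ 0) {e c d e' c' d' : ℤ}
    (he : e = 1 ∨ e = -1) (he' : e' = 1 ∨ e' = -1) {p : Plane}
    (hp : p ∈ interior (cell ℓ e c d)) (hp' : p ∈ interior (cell ℓ e' c' d')) :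
    e = e' ∧ c = c' ∧ d = d' := by
  obtain ⟨h1, h2, h3⟩ := interior_cell_subset hℓ he c d hp
  obtain ⟨k1, k2, k3⟩ := interior_cell_subset hℓ he' c' d' hp'
  have key : ∀ a b : ℤ, (a : ℝ) < b + 1 → a ≤ b := fun a b h => by
    have : a < b + 1 := by exact_mod_cast h
    omega
  rcases he with rfl | rfl <;> rcases he' with rfl | rfl <;>
    push_cast at h1 h2 h3 k1 k2 k3
  · have a1 := key c c' (by linarith)
    have a2 := key c' c (by linarith)
    have a3 := key d d' (by linarith)
    have a4 := key d' d (by linarith)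
    exact ⟨rfl, le_antisymm a1 a2, le_antisymm a3 a4⟩
  · have a1 := key (c + 1) c' (by push_cast; linarith)
    have a2 := key (d + 1) d' (by push_cast; linarith)
    have a3 := key (c' + d') (c + d + 1) (by push_cast; linarith)
    omega
  · have a1 := key (c' + 1) c (by push_cast; linarith)
    have a2 := key (d' + 1) d (by push_cast; linarith)
    have a3 := key (c + d) (c' + d' + 1) (by push_cast; linarith)
    omega
  · have a1 := key c c' (by linarith)
    have a2 := key c' c (by linarith)
    have a3 := key d d' (by linarith)
    have a4 := key d' d (by linarith)
    exact ⟨rfl, le_antisymm a1 a2, le_antisymm a3 a4⟩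

theorem dilation_eq (ℓ : ℝ) (n : ℕ) (p : Plane) :
    dilation ℓ n p = (n : ℝ) • p + (1 - n : ℝ) • vertex ℓ 0 := by
  ext i
  fin_cases i <;> simp [dilation, vertex]

theorem interior_preimage_dilation {ℓ : ℝ} {n : ℕ} (hn : 1 ≤ n) (s : Set Plane) :
    interior (dilation ℓ n ⁻¹' s) = dilation ℓ n ⁻¹' interior s := by
  have hn0 : (n : ℝ) ≠ 0 := by positivity
  have h : dilation ℓ n =
      (Homeomorph.smulOfNeZero (n : ℝ) hn0).trans
        (Homeomorph.addRight ((1 - n : ℝ) • vertex ℓ 0)) :=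
    funext fun p => dilation_eq ℓ n p
  rw [h, Homeomorph.preimage_interior]

/-! ### The decomposition of the triangle -/

/-- The triangles of the tiling inside the dilated triangle, indexed by a square: the pairs
with `i + j < n` give the translates of the original triangle, and the others give the
point-reflected ones, with the corner `(n - i, n - j)`. -/
def cellOfPair (ℓ : ℝ) (n : ℕ) (i j : Fin n) : Set Plane :=
  if (i : ℕ) + j < n then cell ℓ 1 i j else cell ℓ (-1) (n - i) (n - j)

theorem iUnion_preimage_cellOfPair {ℓ : ℝ} (hℓ : ℓ ≠ 0) {n : ℕ} (hn : 1 ≤ n) :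
    ⋃ ij : Fin n × Fin n, dilation ℓ n ⁻¹' cellOfPair ℓ n ij.1 ij.2 = triangle ℓ := by
  have hn0 : (1 : ℝ) ≤ n := by exact_mod_cast hn
  ext p
  have hmem : p ∈ triangle ℓ ↔ 0 ≤ n * bary ℓ 1 p ∧ 0 ≤ n * bary ℓ 2 p ∧
      n * bary ℓ 1 p + n * bary ℓ 2 p ≤ n := by
    have hsum : n * bary ℓ 1 p + n * bary ℓ 2 p ≤ n ↔ bary ℓ 1 p + bary ℓ 2 p ≤ 1 := by
      rw [← mul_add]
      exact mul_le_iff_le_one_right (by linarith)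
    rw [triangle_eq_cell hℓ, hsum, mul_nonneg_iff_of_pos_left (by linarith),
      mul_nonneg_iff_of_pos_left (by linarith)]
    simp [cell]
  have hcell : ∀ e c d : ℤ, dilation ℓ n p ∈ cell ℓ e c d ↔
      0 ≤ e * (n * bary ℓ 1 p - c) ∧ 0 ≤ e * (n * bary ℓ 2 p - d) ∧
        e * (n * bary ℓ 1 p + n * bary ℓ 2 p - c - d) ≤ 1 := fun e c d => by
    simp only [cell, Set.mem_ofPred_eq, bary_dilation hℓ]
  rw [hmem, Set.mem_iUnion]
  generalize (n : ℝ) * bary ℓ 1 p = X at hcell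
  generalize (n : ℝ) * bary ℓ 2 p = Y at hcell
  constructor
  · rintro ⟨⟨i, j⟩, hij⟩
    rw [Set.mem_preimage, cellOfPair] at hij
    split_ifs at hij with hlt <;> rw [hcell] at hij <;> obtain ⟨h1, h2, h3⟩ := hij <;>
      push_cast at h1 h2 h3
    · have hlt' : (i : ℝ) + (j : ℝ) + 1 ≤ n := by exact_mod_cast hlt
      refine ⟨?_, ?_, ?_⟩ <;> linarith [Nat.cast_nonneg (α := ℝ) i, Nat.cast_nonneg (α := ℝ) j]
    · have hge : (n : ℝ) ≤ (i : ℝ) + (j : ℝ) := by exact_mod_cast not_lt.1 hlt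
      have hi : (i : ℝ) + 1 ≤ n := by exact_mod_cast i.2
      have hj : (j : ℝ) + 1 ≤ n := by exact_mod_cast j.2
      refine ⟨?_, ?_, ?_⟩ <;> linarith
  · rintro ⟨hX, hY, hXY⟩
    have up : ∀ i j : ℕ, i + j < n → (i : ℝ) ≤ X → (j : ℝ) ≤ Y → X + Y ≤ i + j + 1 →
        ∃ ij : Fin n × Fin n, p ∈ dilation ℓ n ⁻¹' cellOfPair ℓ n ij.1 ij.2 := by
      intro i j hij h1 h2 h3
      refine ⟨(⟨i, by omega⟩, ⟨j, by omega⟩), ?_⟩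
      rw [Set.mem_preimage, cellOfPair, if_pos hij, hcell]
      push_cast
      refine ⟨?_, ?_, ?_⟩ <;> linarith
    have hi1 := Nat.floor_le hX
    have hi2 := Nat.lt_floor_add_one X
    have hj1 := Nat.floor_le hY
    have hj2 := Nat.lt_floor_add_one Y
    generalize ⌊X⌋₊ = i at hi1 hi2
    generalize ⌊Y⌋₊ = j at hj1 hj2
    have hijn : i + j ≤ n := by
      have : (i + j : ℝ) ≤ n := by linarith
      exact_mod_cast this
    by_cases hup : X + Y ≤ i + j + 1
    · rcases hijn.lt_or_eq with hlt | heq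
      · exact up i j hlt hi1 hj1 hup
      · -- On the side opposite to vertex `0` the floors point to a triangle outside.
        have heq' : (i + j : ℝ) = n := by exact_mod_cast heq
        rcases Nat.eq_zero_or_pos i with rfl | hi
        · obtain ⟨m, rfl⟩ : ∃ m, j = m + 1 := ⟨j - 1, by omega⟩
          push_cast at *
          exact up 0 m (by omega) (by push_cast; linarith) (by linarith) (by push_cast; linarith)
        · obtain ⟨m, rfl⟩ : ∃ m, i = m + 1 := ⟨i - 1, by omega⟩
          push_cast at *
          exact up m j (by omega) (by linarith) (by linarith) (by linarith)
    · have hlt : i + j + 1 < n := by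
        have : (i + j + 1 : ℝ) < n := by linarith
        exact_mod_cast this
      refine ⟨(⟨n - (i + 1), by omega⟩, ⟨n - (j + 1), by omega⟩), ?_⟩
      rw [Set.mem_preimage, cellOfPair, if_neg (by simp only; omega), hcell]
      have e1 : ((n - (i + 1) : ℕ) : ℝ) = n - (i + 1) := by
        rw [Nat.cast_sub (by omega)]; push_cast; ring
      have e2 : ((n - (j + 1) : ℕ) : ℝ) = n - (j + 1) := by
        rw [Nat.cast_sub (by omega)]; push_cast; ring
      push_cast [e1, e2]
      refine ⟨?_, ?_, ?_⟩ <;> linarith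

theorem cellOfPair_eq_of_mem_interior {ℓ : ℝ} (hℓ : ℓ ≠ 0) {n : ℕ} {a b : Fin n × Fin n}
    {p : Plane} (ha : p ∈ interior (cellOfPair ℓ n a.1 a.2))
    (hb : p ∈ interior (cellOfPair ℓ n b.1 b.2)) : a = b := by
  have ha1 := a.1.2
  have ha2 := a.2.2
  have hb1 := b.1.2
  have hb2 := b.2.2
  unfold cellOfPair at ha hb
  apply Prod.ext <;> apply Fin.ext <;> split_ifs at ha hb <;>
    have h := eq_of_mem_interior_cell hℓ (by norm_num) (by norm_num) ha hb <;> omega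

theorem exists_isReflectedDecomposition {ℓ : ℝ} (hℓ : ℓ ≠ 0) {f F : Plane → ℝ}
    (hF : IsOdd ℓ F) (hfF : Set.EqOn F f (triangle ℓ)) {n : ℕ} (hn : 1 ≤ n) :
    ∃ W : Fin (n ^ 2) → List (Fin 3),
      IsReflectedDecomposition ℓ n f (harmonic ℓ n F) W := by
  have hword : ∀ ij : Fin n × Fin n, ∃ w,
      composeReflections ℓ w '' triangle ℓ = cellOfPair ℓ n ij.1 ij.2 := fun ij => by
    unfold cellOfPair
    split_ifs
    · exact exists_composeReflections_image_eq hℓ (.inl rfl) _ _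
    · exact exists_composeReflections_image_eq hℓ (.inr rfl) _ _
  choose w hw using hword
  let φ : Fin (n ^ 2) ≃ Fin n × Fin n := (finCongr (pow_two n)).trans finProdFinEquiv.symm
  have hsub : ∀ j, subTriangle ℓ n (w (φ j)) =
      dilation ℓ n ⁻¹' cellOfPair ℓ n (φ j).1 (φ j).2 := fun j => by rw [subTriangle, hw]
  refine ⟨fun j => w (φ j), ⟨?_, ?_, ?_⟩⟩
  · simp only [hsub]
    rw [← iUnion_preimage_cellOfPair hℓ hn]
    exact φ.surjective.iUnion_comp fun ij => dilation ℓ n ⁻¹' cellOfPair ℓ n ij.1 ij.2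
  · intro i j hij
    rw [hsub, hsub, interior_preimage_dilation hn, interior_preimage_dilation hn,
      Set.disjoint_left]
    exact fun p hi hj => hij (φ.injective (cellOfPair_eq_of_mem_interior hℓ hi hj))
  · intro j p hp q hq
    rw [harmonic, hq, hF.composeReflections, hfF hp]

/-! ### The Laplacian of the plane -/

/-- The partial derivative with respect to coordinate `i`. -/
def partialDeriv (i : Fin 2) (F : Plane → ℝ) (p : Plane) : ℝ :=
  fderiv ℝ F p (EuclideanSpace.single i 1)

theorem laplacian_eq_fderiv_fderiv (F : Plane → ℝ) (p : Plane) :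
    Laplacian.laplacian F p = ∑ i : Fin 2, fderiv ℝ (fderiv ℝ F) p
      (EuclideanSpace.single i 1) (EuclideanSpace.single i 1) := by
  rw [InnerProductSpace.laplacian_eq_iteratedFDeriv_orthonormalBasis F
    (EuclideanSpace.basisFun (Fin 2) ℝ)]
  simp [iteratedFDeriv_two_apply]

theorem partialDeriv_partialDeriv {F : Plane → ℝ} {p : Plane} (hF : ContDiffAt ℝ 2 F p)
    (i j : Fin 2) : partialDeriv i (partialDeriv j F) p = fderiv ℝ (fderiv ℝ F) p
      (EuclideanSpace.single i 1) (EuclideanSpace.single j 1) := by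
  have hd : DifferentiableAt ℝ (fderiv ℝ F) p :=
    (hF.fderiv_right (m := 1) (by norm_num)).differentiableAt (by norm_num)
  have h : fderiv ℝ (fun q => fderiv ℝ F q (EuclideanSpace.single j 1)) p =
      (fderiv ℝ (fderiv ℝ F) p).flip (EuclideanSpace.single j 1) := by
    rw [fderiv_clm_apply hd (differentiableAt_const _)]
    simp
  change fderiv ℝ (fun q => fderiv ℝ F q (EuclideanSpace.single j 1)) p _ = _
  rw [h, ContinuousLinearMap.flip_apply]

theorem laplacian_eq_partialDeriv {F : Plane → ℝ} {p : Plane} (hF : ContDiffAt ℝ 2 F p) :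
    Laplacian.laplacian F p =
      partialDeriv 0 (partialDeriv 0 F) p + partialDeriv 1 (partialDeriv 1 F) p := by
  rw [laplacian_eq_fderiv_fderiv, Fin.sum_univ_two, partialDeriv_partialDeriv hF,
    partialDeriv_partialDeriv hF]

theorem laplacian_comp_smul_add (F : Plane → ℝ) (c : ℝ) (v p : Plane) :
    Laplacian.laplacian (fun q => F (c • q + v)) p = c ^ 2 * Laplacian.laplacian F (c • p + v) := by
  have h1 : ∀ {E : Type} [NormedAddCommGroup E] [NormedSpace ℝ E] (G : Plane → E) (q : Plane),
      fderiv ℝ (fun q => G (c • q + v)) q = c • fderiv ℝ G (c • q + v) := fun G q => by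
    rw [fderiv_comp_smul (f := fun x => G (x + v)) c, fderiv_comp_add_right]
  rw [laplacian_eq_fderiv_fderiv, laplacian_eq_fderiv_fderiv, Finset.mul_sum]
  refine Finset.sum_congr rfl fun i _ => ?_
  have h2 : fderiv ℝ (fun q => F (c • q + v)) = fun q => c • fderiv ℝ F (c • q + v) :=
    funext fun q => h1 F q
  have h3 : fderiv ℝ (fun q => c • fderiv ℝ F (c • q + v)) p =
      c • fderiv ℝ (fun q => fderiv ℝ F (c • q + v)) p := by
    exact congrFun (fderiv_const_smul_field (R := ℝ) (𝕜 := ℝ)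
      (f := fun q => fderiv ℝ F (c • q + v)) c) p
  rw [h2, h3, h1]
  simp only [_root_.smul_apply, smul_eq_mul]
  ring

/-- `F` is a smooth solution of `∇² F + κ F = 0` on the whole plane. -/
def IsHelmholtz (κ : ℝ) (F : Plane → ℝ) : Prop :=
  ContDiff ℝ ∞ F ∧ ∀ p, Laplacian.laplacian F p + κ * F p = 0

theorem contDiffAt_two {F : Plane → ℝ} (hF : ContDiff ℝ ∞ F) (p : Plane) : ContDiffAt ℝ 2 F p :=
  (contDiff_infty.1 hF 2).contDiffAt

theorem IsHelmholtz.add {κ : ℝ} {F G : Plane → ℝ} (hF : IsHelmholtz κ F)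
    (hG : IsHelmholtz κ G) : IsHelmholtz κ (F + G) := by
  refine ⟨hF.1.add hG.1, fun p => ?_⟩
  rw [(contDiffAt_two hF.1 p).laplacian_add (contDiffAt_two hG.1 p), Pi.add_apply]
  linear_combination hF.2 p + hG.2 p

theorem IsHelmholtz.smul {κ : ℝ} {F : Plane → ℝ} (hF : IsHelmholtz κ F) (c : ℝ) :
    IsHelmholtz κ (c • F) := by
  refine ⟨contDiff_const.smul hF.1, fun p => ?_⟩
  rw [InnerProductSpace.laplacian_smul c
    (contDiffAt_two hF.1 p), Pi.smul_apply, smul_eq_mul, smul_eq_mul]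
  linear_combination c * hF.2 p

theorem IsHelmholtz.sub {κ : ℝ} {F G : Plane → ℝ} (hF : IsHelmholtz κ F)
    (hG : IsHelmholtz κ G) : IsHelmholtz κ (F - G) := by
  have h := hF.add (hG.smul (-1))
  rwa [neg_one_smul, ← sub_eq_add_neg] at h

theorem isHelmholtz_zero (κ : ℝ) : IsHelmholtz κ 0 := by
  refine ⟨contDiff_const, fun p => ?_⟩
  have h : (0 : Plane → ℝ) = fun _ => 0 := rfl
  simp [laplacian_eq_fderiv_fderiv, h]

theorem isHelmholtz_cos (a b c : ℝ) :
    IsHelmholtz (a ^ 2 + b ^ 2) fun p : Plane => Real.cos (a * p 0 + b * p 1 + c) := by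
  have hs : ContDiff ℝ ∞ fun p : Plane => Real.cos (a * p 0 + b * p 1 + c) := by fun_prop
  refine ⟨hs, fun p => ?_⟩
  let L : Plane →L[ℝ] ℝ := a • EuclideanSpace.proj 0 + b • EuclideanSpace.proj 1
  have hL : ∀ q : Plane, HasFDerivAt (fun p : Plane => a * p 0 + b * p 1 + c) L q := fun q =>
    (L.hasFDerivAt (x := q)).add_const c
  have h1 : ∀ i, partialDeriv i (fun p : Plane => Real.cos (a * p 0 + b * p 1 + c)) =
      fun p => -L (EuclideanSpace.single i 1) * Real.sin (a * p 0 + b * p 1 + c) := fun i => by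
    funext q
    rw [partialDeriv, (hL q).cos.fderiv]
    simp
    ring
  have h2 : ∀ i, partialDeriv i (partialDeriv i
      (fun p : Plane => Real.cos (a * p 0 + b * p 1 + c))) p =
      -L (EuclideanSpace.single i 1) ^ 2 * Real.cos (a * p 0 + b * p 1 + c) := fun i => by
    rw [h1, partialDeriv, ((hL p).sin.const_mul _).fderiv]
    simp
    ring
  rw [laplacian_eq_partialDeriv (contDiffAt_two hs p), h2, h2]
  simp [L]
  ring

/-! ### The trigonometric eigenfunctions -/

/-- Three affine functions with sum zero which the side reflections permute up to multiples of
`2π`; their successive differences are `2π` times the barycentric coordinates `0` and `1`. -/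
def phase (ℓ : ℝ) (i : Fin 3) (p : Plane) : ℝ :=
  ![2 * Real.pi / 3 * (2 * bary ℓ 0 p + bary ℓ 1 p), 2 * Real.pi / 3 * (bary ℓ 1 p - bary ℓ 0 p),
    -(2 * Real.pi / 3 * (bary ℓ 0 p + 2 * bary ℓ 1 p))] i

/-- The alternating sum of `cos (m a + n b + φ)` over the permutations of `a`, `b`, `c`. -/
def altCos (m n : ℤ) (φ a b c : ℝ) : ℝ :=
  Real.cos (m * a + n * b + φ) - Real.cos (m * b + n * a + φ) +
  (Real.cos (m * b + n * c + φ) - Real.cos (m * c + n * b + φ)) +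
  (Real.cos (m * c + n * a + φ) - Real.cos (m * a + n * c + φ))

/-- The trigonometric Dirichlet eigenfunctions of the equilateral triangle; `φ` is a phase
shift. -/
def eigenfun (ℓ : ℝ) (m n : ℤ) (φ : ℝ) (p : Plane) : ℝ :=
  altCos m n φ (phase ℓ 0 p) (phase ℓ 1 p) (phase ℓ 2 p)

/-- The eigenvalue of `eigenfun ℓ m n φ`. -/
def eigenval (ℓ : ℝ) (m n : ℤ) : ℝ := 16 * Real.pi ^ 2 / (27 * ℓ ^ 2) * (m ^ 2 - m * n + n ^ 2)

theorem phase_zero (ℓ : ℝ) (p : Plane) :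
    phase ℓ 0 p = 2 * Real.pi / 3 * (2 * bary ℓ 0 p + bary ℓ 1 p) := rfl

theorem phase_one (ℓ : ℝ) (p : Plane) :
    phase ℓ 1 p = 2 * Real.pi / 3 * (bary ℓ 1 p - bary ℓ 0 p) := rfl

theorem phase_two (ℓ : ℝ) (p : Plane) :
    phase ℓ 2 p = -(2 * Real.pi / 3 * (bary ℓ 0 p + 2 * bary ℓ 1 p)) := rfl

theorem isHelmholtz_cos_phase (ℓ : ℝ) (m n : ℤ) (φ : ℝ) {i j : Fin 3} (hij : i ≠ j) :
    IsHelmholtz (eigenval ℓ m n)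
      fun p => Real.cos (m * phase ℓ i p + n * phase ℓ j p + φ) := by
  have h := sqrt_three_mul_self
  -- The gradients of the phases have equal length and sum zero.
  let a : Fin 3 → ℝ := ![2 * Real.pi / (3 * ℓ), -(2 * Real.pi / (3 * ℓ)), 0]
  let b : Fin 3 → ℝ := ![2 * Real.pi / (9 * ℓ) * √3, 2 * Real.pi / (9 * ℓ) * √3,
    -(4 * Real.pi / (9 * ℓ) * √3)]
  let c : Fin 3 → ℝ := ![2 * Real.pi / 3, 0, -(2 * Real.pi / 3)]
  have hphase : ∀ i p, phase ℓ i p = a i * p 0 + b i * p 1 + c i := by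
    intro i p
    fin_cases i <;> simp [phase, bary, a, b, c] <;> ring
  have hsq : ∀ i, a i ^ 2 + b i ^ 2 = 16 * Real.pi ^ 2 / (27 * ℓ ^ 2) := by
    intro i
    fin_cases i <;> simp [a, b] <;> ring_nf <;> norm_num [Real.sq_sqrt] <;> ring
  have hmul : a i * a j + b i * b j = -(1 / 2) * (16 * Real.pi ^ 2 / (27 * ℓ ^ 2)) := by
    fin_cases i <;> fin_cases j <;>
      first | exact absurd rfl hij | (simp [a, b]; ring_nf; norm_num [Real.sq_sqrt]; ring)
  have hval : eigenval ℓ m n = (m * a i + n * a j) ^ 2 + (m * b i + n * b j) ^ 2 := by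
    rw [eigenval]
    linear_combination -(m : ℝ) ^ 2 * hsq i - (n : ℝ) ^ 2 * hsq j - 2 * (m : ℝ) * n * hmul
  rw [hval]
  convert isHelmholtz_cos (m * a i + n * a j) (m * b i + n * b j) (m * c i + n * c j + φ)
    using 3 with p
  rw [hphase, hphase]
  ring

theorem isHelmholtz_eigenfun (ℓ : ℝ) (m n : ℤ) (φ : ℝ) :
    IsHelmholtz (eigenval ℓ m n) (eigenfun ℓ m n φ) := by
  have h {i j : Fin 3} (hij : i ≠ j) := isHelmholtz_cos_phase ℓ m n φ hij
  exact (((h (i := 0) (j := 1) (by decide)).sub (h (i := 1) (j := 0) (by decide))).add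
    ((h (i := 1) (j := 2) (by decide)).sub (h (i := 2) (j := 1) (by decide)))).add
    ((h (i := 2) (j := 0) (by decide)).sub (h (i := 0) (j := 2) (by decide)))

theorem altCos_add_two_pi (m n : ℤ) (φ a b c : ℝ) :
    altCos m n φ (a + 2 * Real.pi) b (c - 2 * Real.pi) = altCos m n φ a b c := by
  have key : ∀ (x y : ℝ) (k : ℤ), x = y + k * (2 * Real.pi) → Real.cos x = Real.cos y := by
    rintro _ y k rfl
    exact Real.cos_add_int_mul_two_pi y k
  unfold altCos
  congr 1
  · congr 1
    · congr 1
      · exact key _ _ m (by ring)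
      · exact key _ _ n (by ring)
    · congr 1
      · exact key _ _ (-n) (by push_cast; ring)
      · exact key _ _ (-m) (by push_cast; ring)
  · congr 1
    · exact key _ _ (n - m) (by push_cast; ring)
    · exact key _ _ (m - n) (by push_cast; ring)

theorem isOdd_eigenfun {ℓ : ℝ} (hℓ : ℓ ≠ 0) (m n : ℤ) (φ : ℝ) : IsOdd ℓ (eigenfun ℓ m n φ) := by
  intro i p
  have h0 := bary_zero_eq ℓ p
  unfold eigenfun
  fin_cases i
  · have e0 : phase ℓ 0 (sideReflection ℓ 0 p) = phase ℓ 1 p := by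
      simp [phase, bary_sideReflection hℓ]; ring
    have e1 : phase ℓ 1 (sideReflection ℓ 0 p) = phase ℓ 0 p := by
      simp [phase, bary_sideReflection hℓ]; ring
    have e2 : phase ℓ 2 (sideReflection ℓ 0 p) = phase ℓ 2 p := by
      simp [phase, bary_sideReflection hℓ]; ring
    simp only [Fin.zero_eta, e0, e1, e2, altCos]
    ring
  · have e0 : phase ℓ 0 (sideReflection ℓ 1 p) = phase ℓ 0 p := by
      simp [phase, bary_sideReflection hℓ]; ring
    have e1 : phase ℓ 1 (sideReflection ℓ 1 p) = phase ℓ 2 p := by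
      simp [phase, bary_sideReflection hℓ]; ring
    have e2 : phase ℓ 2 (sideReflection ℓ 1 p) = phase ℓ 1 p := by
      simp [phase, bary_sideReflection hℓ]; ring
    simp only [Fin.mk_one, e0, e1, e2, altCos]
    ring
  · have e0 : phase ℓ 0 (sideReflection ℓ 2 p) = phase ℓ 2 p + 2 * Real.pi := by
      simp [phase, bary_sideReflection hℓ]; rw [h0]; ring
    have e1 : phase ℓ 1 (sideReflection ℓ 2 p) = phase ℓ 1 p := by
      simp [phase, bary_sideReflection hℓ]
    have e2 : phase ℓ 2 (sideReflection ℓ 2 p) = phase ℓ 0 p - 2 * Real.pi := by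
      simp [phase, bary_sideReflection hℓ]; rw [h0]; ring
    simp only [Fin.reduceFinMk, e0, e1, e2, altCos_add_two_pi]
    unfold altCos
    ring

theorem finite_eigenval_eq {ℓ : ℝ} (hℓ : ℓ ≠ 0) (κ : ℝ) :
    {mn : ℤ × ℤ | eigenval ℓ mn.1 mn.2 = κ}.Finite := by
  have hc : 0 < 16 * Real.pi ^ 2 / (27 * ℓ ^ 2) := by
    have := Real.pi_pos
    positivity
  obtain ⟨N, hN⟩ := exists_nat_ge (2 * κ / (16 * Real.pi ^ 2 / (27 * ℓ ^ 2)))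
  refine ((Set.finite_Icc (-N : ℤ) N).prod (Set.finite_Icc (-N : ℤ) N)).subset ?_
  rintro ⟨m, n⟩ h
  simp only [Set.mem_ofPred_eq, eigenval] at h
  have h' : 2 * κ / (16 * Real.pi ^ 2 / (27 * ℓ ^ 2)) = 2 * (m ^ 2 - m * n + n ^ 2) := by
    rw [← h]; field_simp
  rw [h'] at hN
  have hN' : 2 * (m ^ 2 - m * n + n ^ 2) ≤ (N : ℤ) := by exact_mod_cast hN
  have h1 : m ^ 2 ≤ N := by nlinarith [sq_nonneg (m - n), sq_nonneg n]
  have h2 : n ^ 2 ≤ N := by nlinarith [sq_nonneg (m - n), sq_nonneg m]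
  have habs : ∀ k : ℤ, k ^ 2 ≤ N → -N ≤ k ∧ k ≤ N := fun k hk =>
    ⟨by nlinarith [sq_nonneg (k + 1)], by nlinarith [sq_nonneg (k - 1)]⟩
  exact ⟨habs m h1, habs n h2⟩

open MeasureTheory Filter Topology

/-! ### Green's identity on a compact convex set -/

theorem eq_Icc_of_slice {K : Set (ℝ × ℝ)} (hK : IsCompact K) (hc : Convex ℝ K) (y : ℝ)
    (hne : {x | (x, y) ∈ K}.Nonempty) :
    {x | (x, y) ∈ K} = Set.Icc (sInf {x | (x, y) ∈ K}) (sSup {x | (x, y) ∈ K}) := by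
  have hconv : Convex ℝ {x | (x, y) ∈ K} := by
    intro u hu v hv a b ha hb hab
    have h := hc hu hv ha hb hab
    have e : a • (u, y) + b • (v, y) = (a • u + b • v, y) := by
      ext
      · rfl
      · simp [← add_mul, hab]
    rw [e] at h
    exact h
  refine eq_Icc_of_connected_compact ⟨hne, hconv.isPreconnected⟩ ?_
  have hclosed : IsClosed {x | (x, y) ∈ K} := hK.isClosed.preimage (by fun_prop)
  refine (hK.image continuous_fst).of_isClosed_subset hclosed ?_
  exact fun x hx => ⟨(x, y), hx, rfl⟩

/-- The integral of a derivative along the first axis over a compact convex set is controlled by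
the boundary values, since lines meet the set in segments with endpoints on the boundary. -/
theorem abs_integral_deriv_fst_le {K : Set (ℝ × ℝ)} (hK : IsCompact K) (hc : Convex ℝ K)
    {g g' : ℝ × ℝ → ℝ} (hg : ∀ z ∈ K, HasDerivAt (fun x => g (x, z.2)) (g' z) z.1)
    (hg' : ContinuousOn g' K) {M : ℝ} (hM0 : 0 ≤ M) (hM : ∀ z ∈ frontier K, |g z| ≤ M) :
    |∫ z in K, g' z| ≤ 2 * M * volume.real (Prod.snd '' K) := by
  have hint : Integrable (K.indicator g') (volume.prod volume) := by
    rw [integrable_indicator_iff hK.measurableSet]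
    exact hg'.integrableOn_compact hK
  have hsnd : IsCompact (Prod.snd '' K) := hK.image continuous_snd
  have hslice : ∀ y, |∫ x, K.indicator g' (x, y)| ≤ 2 * M := by
    intro y
    have hset : (fun x => K.indicator g' (x, y)) =
        {x | (x, y) ∈ K}.indicator fun x => g' (x, y) := by
      funext x
      simp [Set.indicator]
    by_cases hne : {x | (x, y) ∈ K}.Nonempty
    · have hIcc := eq_Icc_of_slice hK hc y hne
      set a := sInf {x | (x, y) ∈ K}
      set b := sSup {x | (x, y) ∈ K}
      have hab : a ≤ b := Set.nonempty_Icc.1 (hIcc ▸ hne)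
      have hmem : ∀ x ∈ Set.Icc a b, (x, y) ∈ K := fun x hx => by
        rw [← hIcc] at hx
        exact hx
      have hfront : ∀ x ∈ Set.Icc a b, x ∉ Set.Ioo a b → (x, y) ∈ frontier K := by
        intro x hx hx'
        refine ⟨subset_closure (hmem x hx), fun hint => hx' ?_⟩
        have hsub : (fun u : ℝ => (u, y)) ⁻¹' interior K ⊆ Set.Icc a b := fun u hu => by
          rw [← hIcc]
          exact interior_subset (s := K) hu
        have h := interior_maximal hsub (isOpen_interior.preimage (by fun_prop)) hint
        rwa [interior_Icc] at h
      have hFTC : ∫ x in a..b, g' (x, y) = g (b, y) - g (a, y) := by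
        apply intervalIntegral.integral_eq_sub_of_hasDerivAt (f := fun x => g (x, y))
        · intro x hx
          rw [Set.uIcc_of_le hab] at hx
          exact hg (x, y) (hmem x hx)
        · apply ContinuousOn.intervalIntegrable
          rw [Set.uIcc_of_le hab]
          exact hg'.comp (by fun_prop) fun x hx => hmem x hx
      rw [hset, hIcc, integral_indicator measurableSet_Icc, integral_Icc_eq_integral_Ioc,
        ← intervalIntegral.integral_of_le hab, hFTC]
      have hb := hM _ (hfront b (Set.right_mem_Icc.2 hab) fun h => lt_irrefl _ h.2)
      have ha := hM _ (hfront a (Set.left_mem_Icc.2 hab) fun h => lt_irrefl _ h.1)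
      have := abs_sub (g (b, y)) (g (a, y))
      linarith
    · rw [Set.not_nonempty_iff_eq_empty] at hne
      rw [hset, hne]
      simpa using hM0
  have hzero : ∀ y, y ∉ Prod.snd '' K → ∫ x, K.indicator g' (x, y) = 0 := by
    intro y hy
    have : ∀ x, K.indicator g' (x, y) = 0 := fun x =>
      Set.indicator_of_notMem (fun h => hy ⟨_, h, rfl⟩) _
    simp [this]
  rw [← integral_indicator hK.measurableSet, Measure.volume_eq_prod, integral_prod_symm _ hint,
    ← setIntegral_eq_integral_of_forall_compl_eq_zero hzero, ← Real.norm_eq_abs]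
  exact norm_setIntegral_le_of_norm_le_const hsnd.measure_lt_top fun y _ => hslice y

/-- Cartesian coordinates of the plane, as a pair. -/
def planeEquiv : (ℝ × ℝ) ≃L[ℝ] Plane :=
  (ContinuousLinearEquiv.finTwoArrow ℝ ℝ).symm.trans (EuclideanSpace.equiv (Fin 2) ℝ).symm

theorem measurePreserving_planeEquiv : MeasurePreserving planeEquiv :=
  (PiLp.volume_preserving_toLp (Fin 2)).comp (volume_preserving_finTwoArrow ℝ).symm

theorem abs_integral_fderiv_le {K : Set Plane} (hK : IsCompact K) (hc : Convex ℝ K)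
    (T : (ℝ × ℝ) ≃L[ℝ] Plane) (hT : MeasurePreserving T) :
    ∃ C, 0 ≤ C ∧ ∀ g : Plane → ℝ, (∀ p ∈ K, DifferentiableAt ℝ g p) →
      ContinuousOn (fun p => fderiv ℝ g p (T (1, 0))) K →
      ∀ M, 0 ≤ M → (∀ p ∈ frontier K, |g p| ≤ M) →
        |∫ p in K, fderiv ℝ g p (T (1, 0))| ≤ C * M := by
  have hK' : IsCompact (T ⁻¹' K) := T.toHomeomorph.isCompact_preimage.2 hK
  have hc' : Convex ℝ (T ⁻¹' K) := hc.linear_preimage (T : (ℝ × ℝ) →ₗ[ℝ] Plane)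
  refine ⟨2 * volume.real (Prod.snd '' (T ⁻¹' K)), by positivity, fun g hg hg' M hM0 hM => ?_⟩
  have h := abs_integral_deriv_fst_le hK' hc' (g := g ∘ T)
    (g' := fun z => fderiv ℝ g (T z) (T (1, 0))) ?_ ?_ hM0 ?_
  · rw [← hT.setIntegral_preimage_emb T.toHomeomorph.measurableEmbedding]
    refine h.trans (le_of_eq (by ring))
  · intro z hz
    have h1 : HasDerivAt (fun x : ℝ => T (x, z.2)) (T (1, 0)) z.1 := by
      have : HasDerivAt (fun x : ℝ => (x, z.2)) ((1, 0) : ℝ × ℝ) z.1 :=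
        (hasDerivAt_id _).prodMk (hasDerivAt_const _ _)
      exact (T : (ℝ × ℝ) →L[ℝ] Plane).hasFDerivAt.comp_hasDerivAt _ this
    exact (hg _ hz).hasFDerivAt.comp_hasDerivAt z.1 h1
  · exact hg'.comp T.continuous.continuousOn fun z hz => hz
  · intro z hz
    apply hM
    have := T.toHomeomorph.preimage_frontier K
    change z ∈ frontier (T.toHomeomorph ⁻¹' K) at hz
    rw [← this] at hz
    exact hz

theorem abs_integral_partialDeriv_le {K : Set Plane} (hK : IsCompact K) (hc : Convex ℝ K)
    (i : Fin 2) :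
    ∃ C, 0 ≤ C ∧ ∀ g : Plane → ℝ, (∀ p ∈ K, DifferentiableAt ℝ g p) →
      ContinuousOn (partialDeriv i g) K → ∀ M, 0 ≤ M → (∀ p ∈ frontier K, |g p| ≤ M) →
        |∫ p in K, partialDeriv i g p| ≤ C * M := by
  obtain ⟨T, hT, hTi⟩ : ∃ T : (ℝ × ℝ) ≃L[ℝ] Plane, MeasurePreserving T ∧
      T (1, 0) = EuclideanSpace.single i 1 := by
    fin_cases i
    · refine ⟨planeEquiv, measurePreserving_planeEquiv, ?_⟩
      ext j
      fin_cases j <;> simp [planeEquiv]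
    · refine ⟨(ContinuousLinearEquiv.prodComm ℝ ℝ ℝ).trans planeEquiv,
        measurePreserving_planeEquiv.comp Measure.measurePreserving_swap, ?_⟩
      ext j
      fin_cases j <;> simp [planeEquiv]
  have h := abs_integral_fderiv_le hK hc T hT
  rw [hTi] at h
  exact h

theorem contDiffAt_partialDeriv {F : Plane → ℝ} {p : Plane} {n m : ℕ} (hF : ContDiffAt ℝ n F p)
    (hmn : m + 1 ≤ n) (i : Fin 2) : ContDiffAt ℝ m (partialDeriv i F) p :=
  (hF.fderiv_right (m := m) (by exact_mod_cast hmn)).clm_apply contDiffAt_const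

/-- Green's identity for a function `ψ` with zero boundary values: the boundary term involves only
the boundary values of the other function, and none of its derivatives. -/
theorem abs_integral_green_le {K : Set Plane} (hK : IsCompact K) (hc : Convex ℝ K) {ψ : Plane → ℝ}
    (hψ : ContDiff ℝ ∞ ψ) (hψ0 : ∀ p ∈ frontier K, ψ p = 0) :
    ∃ C, 0 ≤ C ∧ ∀ h : Plane → ℝ, (∀ p ∈ K, ContDiffAt ℝ 2 h p) →
      ∀ ε, 0 ≤ ε → (∀ p ∈ frontier K, |h p| ≤ ε) →
        |∫ p in K, (h p * Laplacian.laplacian ψ p - ψ p * Laplacian.laplacian h p)| ≤ C * ε := by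
  have hψ2 : ∀ p, ContDiffAt ℝ (2 : ℕ) ψ p := fun p => contDiffAt_two hψ p
  have hfrontier : frontier K ⊆ K := hK.isClosed.frontier_subset
  have key : ∀ i, ∃ C, 0 ≤ C ∧ ∀ h : Plane → ℝ, (∀ p ∈ K, ContDiffAt ℝ 2 h p) →
      ∀ ε, 0 ≤ ε → (∀ p ∈ frontier K, |h p| ≤ ε) →
        ContinuousOn (fun p => h p * partialDeriv i (partialDeriv i ψ) p -
          ψ p * partialDeriv i (partialDeriv i h) p) K ∧
        |∫ p in K, (h p * partialDeriv i (partialDeriv i ψ) p -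
          ψ p * partialDeriv i (partialDeriv i h) p)| ≤ C * ε := by
    intro i
    have hdψ : Continuous (partialDeriv i ψ) := continuous_iff_continuousAt.2 fun p =>
      (contDiffAt_partialDeriv (m := 1) (hψ2 p) le_rfl i).continuousAt
    obtain ⟨B, hB⟩ := hK.exists_bound_of_continuousOn hdψ.continuousOn
    obtain ⟨C, hC0, hC⟩ := abs_integral_partialDeriv_le hK hc i
    refine ⟨C * |B|, by positivity, fun h hh ε hε hbd => ?_⟩
    have hh2 : ∀ p ∈ K, ContDiffAt ℝ (2 : ℕ) h p := fun p hp => hh p hp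
    have hdiff : ∀ {G : Plane → ℝ} {p : Plane}, ContDiffAt ℝ (2 : ℕ) G p →
        DifferentiableAt ℝ G p ∧ DifferentiableAt ℝ (partialDeriv i G) p := fun hG =>
      ⟨hG.differentiableAt (by norm_num),
        (contDiffAt_partialDeriv (m := 1) hG le_rfl i).differentiableAt (by norm_num)⟩
    have hcont : ∀ {G : Plane → ℝ} {p : Plane}, ContDiffAt ℝ (2 : ℕ) G p →
        ContinuousAt (partialDeriv i (partialDeriv i G)) p := fun hG =>
      (contDiffAt_partialDeriv (m := 0) (contDiffAt_partialDeriv (m := 1) hG le_rfl i)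
        le_rfl i).continuousAt
    have hderiv : ∀ p ∈ K, partialDeriv i
        (fun q => h q * partialDeriv i ψ q - ψ q * partialDeriv i h q) p =
        h p * partialDeriv i (partialDeriv i ψ) p - ψ p * partialDeriv i (partialDeriv i h) p := by
      intro p hp
      obtain ⟨h1, h2⟩ := hdiff (hh2 p hp)
      obtain ⟨p1, p2⟩ := hdiff (hψ2 p)
      have := ((h1.hasFDerivAt.mul p2.hasFDerivAt).sub (p1.hasFDerivAt.mul h2.hasFDerivAt)).fderiv
      have e := congrArg (fun L => L (EuclideanSpace.single i 1)) this
      refine e.trans ?_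
      simp [partialDeriv]
      ring
    have hcontOn : ContinuousOn (fun p => h p * partialDeriv i (partialDeriv i ψ) p -
        ψ p * partialDeriv i (partialDeriv i h) p) K := fun p hp =>
      (((hh2 p hp).continuousAt.mul (hcont (hψ2 p))).sub
        ((hψ2 p).continuousAt.mul (hcont (hh2 p hp)))).continuousWithinAt
    refine ⟨hcontOn, ?_⟩
    rw [← setIntegral_congr_fun hK.measurableSet hderiv, mul_assoc]
    refine hC _ (fun p hp => ?_) (hcontOn.congr hderiv) _ (by positivity) fun p hp => ?_
    · obtain ⟨h1, h2⟩ := hdiff (hh2 p hp)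
      obtain ⟨p1, p2⟩ := hdiff (hψ2 p)
      exact (h1.mul p2).sub (p1.mul h2)
    · rw [hψ0 p hp, zero_mul, sub_zero, abs_mul, mul_comm]
      exact mul_le_mul ((hB p (hfrontier hp)).trans (le_abs_self B)) (hbd p hp) (abs_nonneg _)
        (abs_nonneg _)
  obtain ⟨C₀, h₀, H₀⟩ := key 0
  obtain ⟨C₁, h₁, H₁⟩ := key 1
  refine ⟨C₀ + C₁, by positivity, fun h hh ε hε hbd => ?_⟩
  obtain ⟨c₀, i₀⟩ := H₀ h hh ε hε hbd
  obtain ⟨c₁, i₁⟩ := H₁ h hh ε hε hbd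
  have hsum : ∀ p ∈ K, h p * Laplacian.laplacian ψ p - ψ p * Laplacian.laplacian h p =
      (h p * partialDeriv 0 (partialDeriv 0 ψ) p - ψ p * partialDeriv 0 (partialDeriv 0 h) p) +
      (h p * partialDeriv 1 (partialDeriv 1 ψ) p - ψ p * partialDeriv 1 (partialDeriv 1 h) p) := by
    intro p hp
    rw [laplacian_eq_partialDeriv (hψ2 p), laplacian_eq_partialDeriv (hh p hp)]
    ring
  rw [setIntegral_congr_fun hK.measurableSet hsum,
    integral_add (c₀.integrableOn_compact hK) (c₁.integrableOn_compact hK), add_mul]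
  exact (abs_add_le _ _).trans (add_le_add i₀ i₁)

/-- A Dirichlet solution is orthogonal to every smooth Dirichlet solution with another scalar.
Nothing is known about the derivatives of `f` at the boundary, so Green's identity is applied to
`p ↦ f (t p)` with `t < 1`. -/
theorem IsDirichletSolution.integral_mul_eq_zero {ℓ κ lam : ℝ} (hℓ : ℓ ≠ 0) {f ψ : Plane → ℝ}
    (hf : IsDirichletSolution ℓ κ f) (hψ : IsHelmholtz lam ψ)
    (hψ0 : ∀ p ∈ frontier (triangle ℓ), ψ p = 0) (hne : lam ≠ κ) :
    ∫ p in triangle ℓ, f p * ψ p = 0 := by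
  have hK := isCompact_triangle ℓ
  have hfrontier : frontier (triangle ℓ) ⊆ triangle ℓ := (isClosed_triangle ℓ).frontier_subset
  obtain ⟨C, hC0, hC⟩ := abs_integral_green_le hK (convex_triangle ℓ) hψ.1 hψ0
  have hIoo : ∀ᶠ t : ℝ in 𝓝[<] 1, t ∈ Set.Ioo (0 : ℝ) 1 :=
    Ioo_mem_nhdsLT one_pos
  have hmem : ∀ t ∈ Set.Ioo (0 : ℝ) 1, ∀ p ∈ triangle ℓ, t • p ∈ triangle ℓ := fun t ht p hp =>
    interior_subset (smul_mem_interior_triangle hℓ hp ht.1.le ht.2)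
  have hunif : ∀ ε > 0, ∀ᶠ t : ℝ in 𝓝[<] 1, ∀ p ∈ triangle ℓ, |f (t • p) - f p| ≤ ε := by
    intro ε hε
    obtain ⟨δ, hδ, H⟩ := Metric.uniformContinuousOn_iff.1
      (hK.uniformContinuousOn_of_continuous hf.continuousOn) ε hε
    obtain ⟨R, hR⟩ := hK.isBounded.exists_norm_le
    have hlim : Tendsto (fun t : ℝ => (1 - t) * |R|) (𝓝[<] 1) (𝓝 0) := by
      have : Tendsto (fun t : ℝ => (1 - t) * |R|) (𝓝 1) (𝓝 ((1 - 1) * |R|)) :=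
        Continuous.tendsto (by fun_prop) 1
      rw [sub_self, zero_mul] at this
      exact this.mono_left nhdsWithin_le_nhds
    filter_upwards [hIoo, hlim.eventually (gt_mem_nhds hδ)] with t ht htδ p hp
    have hdist : dist (t • p) p < δ := by
      rw [dist_eq_norm, show t • p - p = (t - 1) • p by module, norm_smul, Real.norm_eq_abs,
        abs_sub_comm, abs_of_pos (sub_pos.2 ht.2)]
      refine lt_of_le_of_lt (mul_le_mul_of_nonneg_left ((hR p hp).trans (le_abs_self R)) ?_) htδ
      exact (sub_pos.2 ht.2).le
    exact (H _ (hmem t ht p hp) p hp hdist).le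
  obtain ⟨Bf, hBf⟩ := hK.exists_bound_of_continuousOn hf.continuousOn
  have hψc : Continuous ψ := hψ.1.continuous
  have hlim : Tendsto (fun t : ℝ => ∫ p in triangle ℓ, f (t • p) * ψ p) (𝓝[<] 1)
      (𝓝 (∫ p in triangle ℓ, f p * ψ p)) := by
    refine tendsto_integral_filter_of_dominated_convergence (fun p => Bf * |ψ p|) ?_ ?_ ?_ ?_
    · filter_upwards [hIoo] with t ht
      have hc : ContinuousOn (fun p => f (t • p)) (triangle ℓ) :=
        hf.continuousOn.comp (by fun_prop) (hmem t ht)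
      exact (hc.mul hψc.continuousOn).aestronglyMeasurable hK.measurableSet
    · filter_upwards [hIoo] with t ht
      refine (ae_restrict_iff' hK.measurableSet).2 (ae_of_all _ fun p hp => ?_)
      rw [norm_mul]
      exact mul_le_mul_of_nonneg_right (hBf _ (hmem t ht p hp)) (abs_nonneg _)
    · exact ((continuous_const.mul hψc.abs).continuousOn).integrableOn_compact hK
    · refine (ae_restrict_iff' hK.measurableSet).2 (ae_of_all _ fun p hp => ?_)
      refine Tendsto.mul_const _ (Metric.tendsto_nhds.2 fun ε hε => ?_)
      filter_upwards [hunif (ε / 2) (half_pos hε)] with t ht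
      rw [Real.dist_eq]
      linarith [ht p hp]
  have hlim1 : Tendsto (fun t : ℝ => (t ^ 2 * κ - lam) * ∫ p in triangle ℓ, f (t • p) * ψ p)
      (𝓝[<] 1) (𝓝 ((1 ^ 2 * κ - lam) * ∫ p in triangle ℓ, f p * ψ p)) := by
    refine Tendsto.mul (Tendsto.mono_left ?_ nhdsWithin_le_nhds) hlim
    exact Continuous.tendsto (by fun_prop) 1
  have hlim2 : Tendsto (fun t : ℝ => (t ^ 2 * κ - lam) * ∫ p in triangle ℓ, f (t • p) * ψ p)
      (𝓝[<] 1) (𝓝 0) := by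
    refine Metric.tendsto_nhds.2 fun ε hε => ?_
    have hε' : 0 < ε / (C + 1) := by positivity
    filter_upwards [hIoo, hunif _ hε'] with t ht hbd
    have hsmooth : ∀ p ∈ triangle ℓ, ContDiffAt ℝ 2 (fun q => f (t • q)) p := fun p hp => by
      have h := (hf.contDiffOn.contDiffAt (isOpen_interior.mem_nhds
        (smul_mem_interior_triangle hℓ hp ht.1.le ht.2)))
      exact ContDiffAt.comp p h (contDiff_const_smul t).contDiffAt
    have hgreen := hC (fun q => f (t • q)) hsmooth _ hε'.le fun p hp => by
      have := hbd p (hfrontier hp)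
      rwa [hf.boundary p hp, sub_zero] at this
    have heq : ∀ p ∈ triangle ℓ, f (t • p) * Laplacian.laplacian ψ p -
        ψ p * Laplacian.laplacian (fun q => f (t • q)) p =
        (t ^ 2 * κ - lam) * (f (t • p) * ψ p) := by
      intro p hp
      have h1 := laplacian_comp_smul_add f t 0 p
      have h2 := hf.helmholtz _ (smul_mem_interior_triangle hℓ hp ht.1.le ht.2)
      have h3 := hψ.2 p
      simp only [add_zero] at h1
      rw [h1]
      linear_combination f (t • p) * h3 - ψ p * t ^ 2 * h2
    rw [setIntegral_congr_fun hK.measurableSet heq, integral_const_mul] at hgreen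
    rw [Real.dist_eq, sub_zero]
    refine lt_of_le_of_lt hgreen ?_
    rw [mul_div_assoc', div_lt_iff₀ (by positivity)]
    nlinarith
  have h := tendsto_nhds_unique hlim1 hlim2
  rw [one_pow, one_mul, mul_eq_zero] at h
  exact h.resolve_left (sub_ne_zero.2 hne.symm)

/-! ### Orthogonality of continuous functions on a compact space -/

section Orthogonality

variable {X : Type*} [TopologicalSpace X] [CompactSpace X] [MeasurableSpace X] [BorelSpace X]
  (μ : Measure X) [IsFiniteMeasure μ]

theorem integrable_continuousMap (g : C(X, ℝ)) : Integrable g μ :=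
  g.continuous.integrable_of_hasCompactSupport (HasCompactSupport.of_compactSpace g)

theorem integrable_continuousMap_mul (g h : C(X, ℝ)) : Integrable (fun x => g x * h x) μ :=
  integrable_continuousMap μ (g * h)

theorem eq_zero_of_integral_mul_self [μ.IsOpenPosMeasure] {g : C(X, ℝ)}
    (h : ∫ x, g x * g x ∂μ = 0) : g = 0 := by
  have hae := (integral_eq_zero_iff_of_nonneg (fun x => mul_self_nonneg (g x))
    (integrable_continuousMap μ (g * g))).1 h
  have hzero := (Continuous.ae_eq_iff_eq μ (g * g).continuous continuous_const).1 hae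
  ext x
  exact mul_self_eq_zero.1 (congrFun hzero x)

/-- The orthogonal projection to a finite-dimensional space of continuous functions. -/
theorem exists_mem_forall_integral_sub_mul_eq_zero [μ.IsOpenPosMeasure] (V : Submodule ℝ C(X, ℝ))
    [FiniteDimensional ℝ V] (f : C(X, ℝ)) :
    ∃ v ∈ V, ∀ w ∈ V, ∫ x, (f - v) x * w x ∂μ = 0 := by
  let B : C(X, ℝ) →ₗ[ℝ] C(X, ℝ) →ₗ[ℝ] ℝ := LinearMap.mk₂ ℝ (fun g h => ∫ x, g x * h x ∂μ)
    (fun g g' h => by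
      rw [← integral_add (integrable_continuousMap_mul μ g h) (integrable_continuousMap_mul μ g' h)]
      simp [add_mul])
    (fun c g h => by
      rw [smul_eq_mul, ← integral_const_mul]
      simp [mul_assoc])
    (fun g h h' => by
      rw [← integral_add (integrable_continuousMap_mul μ g h) (integrable_continuousMap_mul μ g h')]
      simp [mul_add])
    (fun c g h => by
      rw [smul_eq_mul, ← integral_const_mul]
      simp [mul_left_comm])
  let Φ : V →ₗ[ℝ] Module.Dual ℝ V := B.domRestrict₁₂ V V
  have hinj : Function.Injective Φ := by
    refine (injective_iff_map_eq_zero Φ).2 fun v hv => ?_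
    have h : ∫ x, (v : C(X, ℝ)) x * (v : C(X, ℝ)) x ∂μ = 0 := DFunLike.congr_fun hv v
    exact Subtype.ext (eq_zero_of_integral_mul_self μ h)
  have hsurj : Function.Surjective Φ :=
    (LinearMap.injective_iff_surjective_of_finrank_eq_finrank Subspace.dual_finrank_eq.symm).1 hinj
  obtain ⟨v, hv⟩ := hsurj ((B f).domRestrict V)
  refine ⟨v, v.2, fun w hw => ?_⟩
  have h : B v w = B f w := DFunLike.congr_fun hv ⟨w, hw⟩
  have h' : B (f - v) w = 0 := by rw [map_sub, LinearMap.sub_apply, h, sub_self]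
  exact h'

/-- A space of functions that is stable under multiplication by an algebra separating points, and
contains a function with dense non-vanishing set, has no orthogonal complement: by the
Stone–Weierstrass theorem the orthogonality extends to all multiples of that function. -/
theorem eq_zero_of_forall_integral_mul_eq_zero [μ.IsOpenPosMeasure] {A : Subalgebra ℝ C(X, ℝ)}
    (hA : A.SeparatesPoints) {Q : Submodule ℝ C(X, ℝ)} (hAQ : ∀ a ∈ A, ∀ q ∈ Q, a * q ∈ Q)
    {q₀ : C(X, ℝ)} (hq₀ : q₀ ∈ Q) (hdense : Dense {x | q₀ x ≠ 0}) {u : C(X, ℝ)}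
    (hu : ∀ q ∈ Q, ∫ x, u x * q x ∂μ = 0) : u = 0 := by
  set h := u * q₀ with hh
  have hle : ∀ ε > 0, ∫ x, h x * h x ∂μ ≤ ε * ∫ x, |h x| ∂μ := by
    intro ε hε
    obtain ⟨a, ha⟩ :=
      ContinuousMap.exists_mem_subalgebra_near_continuousMap_of_separatesPoints A hA h ε hε
    have hzero : ∫ x, h x * (a : C(X, ℝ)) x ∂μ = 0 := by
      rw [← hu _ (hAQ a a.2 q₀ hq₀)]
      refine integral_congr_ae (ae_of_all _ fun x => ?_)
      simp [hh]
      ring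
    have hsub : ∫ x, h x * h x ∂μ = ∫ x, h x * (h x - (a : C(X, ℝ)) x) ∂μ := by
      rw [← sub_zero (∫ x, h x * h x ∂μ), ← hzero,
        ← integral_sub (integrable_continuousMap_mul μ h h) (integrable_continuousMap_mul μ h a)]
      simp [mul_sub]
    rw [hsub, ← integral_const_mul]
    refine integral_mono (integrable_continuousMap μ (h * (h - a)))
      ((integrable_continuousMap μ h).abs.const_mul ε) fun x => ?_
    have hx : |h x - (a : C(X, ℝ)) x| ≤ ε := by
      have h1 := ((a : C(X, ℝ)) - h).norm_coe_le_norm x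
      rw [ContinuousMap.sub_apply, Real.norm_eq_abs, abs_sub_comm] at h1
      exact h1.trans ha.le
    calc h x * (h x - (a : C(X, ℝ)) x) ≤ |h x| * |h x - (a : C(X, ℝ)) x| := by
          rw [← abs_mul]; exact le_abs_self _
      _ ≤ |h x| * ε := mul_le_mul_of_nonneg_left hx (abs_nonneg _)
      _ = ε * |h x| := mul_comm _ _
  have hsq : ∫ x, h x * h x ∂μ = 0 := by
    have hI : 0 ≤ ∫ x, |h x| ∂μ := integral_nonneg fun x => abs_nonneg _
    refine le_antisymm (le_of_forall_pos_le_add fun ε hε => ?_)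
      (integral_nonneg fun x => mul_self_nonneg _)
    refine (hle (ε / (∫ x, |h x| ∂μ + 1)) (by positivity)).trans ?_
    rw [zero_add, div_mul_eq_mul_div, div_le_iff₀ (by positivity)]
    nlinarith
  have h0 := eq_zero_of_integral_mul_self μ hsq
  have hu0 : (u : X → ℝ) = (0 : C(X, ℝ)) := by
    refine Continuous.ext_on hdense u.continuous (map_continuous _) fun x hx => ?_
    have : u x * q₀ x = 0 := DFunLike.congr_fun h0 x
    exact (mul_eq_zero.1 this).resolve_right hx
  exact DFunLike.coe_injective hu0

end Orthogonality

/-! ### Trigonometric identities for alternating sums -/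

/-- Multiplication by an invariant trigonometric polynomial maps alternating sums to
combinations of alternating sums. -/
theorem sum_cos_mul_altCos (m n : ℤ) (φ θ a b c : ℝ) (h : a + b + c = 0) :
    (Real.cos (a + θ) + Real.cos (b + θ) + Real.cos (c + θ)) * altCos m n φ a b c =
      1 / 2 * (altCos (m + 1) n (φ + θ) a b c + altCos (m - 1) n (φ - θ) a b c +
        altCos m (n + 1) (φ + θ) a b c + altCos m (n - 1) (φ - θ) a b c +
        altCos (m - 1) (n - 1) (φ + θ) a b c + altCos (m + 1) (n + 1) (φ - θ) a b c) := by
  have key : ∀ x y z : ℝ, x + y + z = 0 →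
      (Real.cos (x + θ) + Real.cos (y + θ) + Real.cos (z + θ)) * Real.cos (m * x + n * y + φ) =
        1 / 2 * (Real.cos ((m + 1 : ℤ) * x + n * y + (φ + θ)) +
          Real.cos ((m - 1 : ℤ) * x + n * y + (φ - θ)) +
          Real.cos (m * x + (n + 1 : ℤ) * y + (φ + θ)) +
          Real.cos (m * x + (n - 1 : ℤ) * y + (φ - θ)) +
          Real.cos ((m - 1 : ℤ) * x + (n - 1 : ℤ) * y + (φ + θ)) +
          Real.cos ((m + 1 : ℤ) * x + (n + 1 : ℤ) * y + (φ - θ))) := by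
    intro x y z hxyz
    obtain rfl : z = -x - y := by linarith
    have prod : ∀ s t : ℝ,
        Real.cos s * Real.cos t = 1 / 2 * (Real.cos (t + s) + Real.cos (t - s)) :=
      fun s t => by rw [Real.cos_add, Real.cos_sub]; ring
    rw [add_mul, add_mul, prod, prod, prod]
    push_cast
    ring_nf
  have k1 := key a b c h
  have k2 := key b a c (by linarith)
  have k3 := key b c a (by linarith)
  have k4 := key c b a (by linarith)
  have k5 := key c a b (by linarith)
  have k6 := key a c b (by linarith)
  unfold altCos
  linear_combination k1 - k2 + k3 - k4 + k5 - k6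

theorem altCos_add_phase (m n : ℤ) (φ a b c : ℝ) :
    altCos m n φ a b c =
      Real.cos φ * altCos m n 0 a b c + Real.sin φ * altCos m n (Real.pi / 2) a b c := by
  simp only [altCos, Real.cos_add_pi_div_two, Real.cos_add _ φ, add_zero]
  ring

theorem altCos_two_one {a b c : ℝ} (h : a + b + c = 0) :
    altCos 2 1 (Real.pi / 2) a b c =
      8 * Real.sin ((a - b) / 2) * Real.sin ((b - c) / 2) * Real.sin ((a - c) / 2) := by
  obtain ⟨x, hx⟩ : ∃ x, x = (a - b) / 2 := ⟨_, rfl⟩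
  obtain ⟨y, hy⟩ : ∃ y, y = (b - c) / 2 := ⟨_, rfl⟩
  have hxy : (a - c) / 2 = x + y := by rw [hx, hy]; ring
  have e1 : ((2 : ℤ) : ℝ) * a + ((1 : ℤ) : ℝ) * b = 2 * x + 2 * y := by push_cast; linarith
  have e2 : ((2 : ℤ) : ℝ) * b + ((1 : ℤ) : ℝ) * a = 2 * y := by push_cast; linarith
  have e3 : ((2 : ℤ) : ℝ) * b + ((1 : ℤ) : ℝ) * c = -(2 * x) := by push_cast; linarith
  have e4 : ((2 : ℤ) : ℝ) * c + ((1 : ℤ) : ℝ) * b = -(2 * x + 2 * y) := by push_cast; linarith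
  have e5 : ((2 : ℤ) : ℝ) * c + ((1 : ℤ) : ℝ) * a = -(2 * y) := by push_cast; linarith
  have e6 : ((2 : ℤ) : ℝ) * a + ((1 : ℤ) : ℝ) * c = 2 * x := by push_cast; linarith
  rw [hxy, ← hx, ← hy]
  simp only [altCos, Real.cos_add_pi_div_two, e1, e2, e3, e4, e5, e6, Real.sin_neg,
    Real.sin_add, Real.sin_two_mul, Real.cos_two_mul]
  have hsx := Real.sin_sq_add_cos_sq x
  have hsy := Real.sin_sq_add_cos_sq y
  linear_combination (-8 * Real.sin x * Real.cos x) * hsy + (-8 * Real.sin y * Real.cos y) * hsx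

/-! ### Separation of the points of the triangle -/

theorem phase_sum (ℓ : ℝ) (p : Plane) : phase ℓ 0 p + phase ℓ 1 p + phase ℓ 2 p = 0 := by
  rw [phase_zero, phase_one, phase_two]; ring

/-- Triples with equal elementary symmetric functions agree up to a permutation; the third entry is
determined by the first two. -/
theorem perm_of_symmetric_eq {x y z x' y' z' : ℂ} (h1 : x' + y' + z' = x + y + z)
    (h2 : x' * y' + y' * z' + z' * x' = x * y + y * z + z * x) (h3 : x' * y' * z' = x * y * z) :
    (x' = x ∧ (y' = y ∨ y' = z)) ∨ (x' = y ∧ (y' = x ∨ y' = z)) ∨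
      (x' = z ∧ (y' = x ∨ y' = y)) := by
  have hroot : (x' - x) * ((x' - y) * (x' - z)) = 0 := by
    linear_combination x' ^ 2 * h1 - x' * h2 + h3
  have split : ∀ u v w : ℂ, x' = u → y' + z' = v + w →
      x' * y' + y' * z' + z' * x' = u * v + v * w + w * u → y' = v ∨ y' = w := by
    rintro u v w rfl e1 e2
    have : (y' - v) * (y' - w) = 0 := by linear_combination (x' + y') * e1 - e2
    rcases mul_eq_zero.1 this with e | e
    · exact .inl (sub_eq_zero.1 e)
    · exact .inr (sub_eq_zero.1 e)
  rcases mul_eq_zero.1 hroot with e | e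
  · have e := sub_eq_zero.1 e
    exact .inl ⟨e, split x y z e (by linear_combination h1 - e) (by linear_combination h2)⟩
  · rcases mul_eq_zero.1 e with e | e
    · have e := sub_eq_zero.1 e
      exact .inr (.inl ⟨e, split y x z e (by linear_combination h1 - e)
        (by linear_combination h2)⟩)
    · have e := sub_eq_zero.1 e
      exact .inr (.inr ⟨e, split z x y e (by linear_combination h1 - e)
        (by linear_combination h2)⟩)

/-- Angles with sum zero are determined, up to a permutation and multiples of `2π`, by the sum of
their unit vectors: it is the first elementary symmetric function of these, its conjugate is the
second one, and the third one is `1`. -/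
theorem perm_of_sum_cos_sin_eq {a b c a' b' c' : ℝ} (h : a + b + c = 0) (h' : a' + b' + c' = 0)
    (hcos : Real.cos a' + Real.cos b' + Real.cos c' = Real.cos a + Real.cos b + Real.cos c)
    (hsin : Real.sin a' + Real.sin b' + Real.sin c' = Real.sin a + Real.sin b + Real.sin c) :
    let R := fun u v : ℝ => ∃ k : ℤ, u = v + k * (2 * Real.pi)
    (R a' a ∧ (R b' b ∨ R b' c)) ∨ (R a' b ∧ (R b' a ∨ R b' c)) ∨
      (R a' c ∧ (R b' a ∨ R b' b)) := by
  intro R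
  let E : ℝ → ℂ := fun t => Complex.exp (t * Complex.I)
  have hE : ∀ t, E t = Real.cos t + Real.sin t * Complex.I := fun t => by
    simp only [E, Complex.exp_mul_I, Complex.ofReal_cos, Complex.ofReal_sin]
  have hmul : ∀ s t, E s * E t = E (s + t) := fun s t => by
    simp only [E]
    rw [← Complex.exp_add, ← add_mul, Complex.ofReal_add]
  have hR : ∀ u v, E u = E v → R u v := by
    intro u v huv
    obtain ⟨k, hk⟩ := Complex.exp_eq_exp_iff_exists_int.1 huv
    refine ⟨k, ?_⟩
    have : ((u : ℂ) - (v + k * (2 * Real.pi))) * Complex.I = 0 := by linear_combination hk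
    have := sub_eq_zero.1 ((mul_eq_zero.1 this).resolve_right Complex.I_ne_zero)
    exact_mod_cast this
  have e2 : ∀ a b c : ℝ, a + b + c = 0 → E a * E b + E b * E c + E c * E a =
      ((Real.cos a + Real.cos b + Real.cos c : ℝ) : ℂ) -
        ((Real.sin a + Real.sin b + Real.sin c : ℝ) : ℂ) * Complex.I := by
    intro a b c h
    rw [hmul, hmul, hmul, show a + b = -c by linarith, show b + c = -a by linarith,
      show c + a = -b by linarith, hE, hE, hE]
    simp only [Real.cos_neg, Real.sin_neg]
    push_cast
    ring
  have e1 : ∀ a b c : ℝ, E a + E b + E c = ((Real.cos a + Real.cos b + Real.cos c : ℝ) : ℂ) +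
        ((Real.sin a + Real.sin b + Real.sin c : ℝ) : ℂ) * Complex.I := by
    intro a b c
    rw [hE, hE, hE]
    push_cast
    ring
  have hperm := perm_of_symmetric_eq (x := E a) (y := E b) (z := E c) (x' := E a') (y' := E b')
    (z' := E c') (by rw [e1, e1, hcos, hsin]) (by rw [e2 _ _ _ h, e2 _ _ _ h', hcos, hsin])
    (by rw [hmul, hmul, hmul, hmul, h, h'])
  exact hperm.imp (.imp (hR _ _) (.imp (hR _ _) (hR _ _)))
    (.imp (.imp (hR _ _) (.imp (hR _ _) (hR _ _))) (.imp (hR _ _) (.imp (hR _ _) (hR _ _))))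

/-- The function `exp (i A) + exp (i B) + exp (i C)` of the phases `A`, `B`, `C` separates the
points of the triangle, which is a fundamental domain for the permutations and translations. -/
theorem eq_of_sum_cos_phase_eq {ℓ : ℝ} (hℓ : ℓ ≠ 0) {p q : Plane} (hp : p ∈ triangle ℓ)
    (hq : q ∈ triangle ℓ)
    (h : ∀ θ, Real.cos (phase ℓ 0 q + θ) + Real.cos (phase ℓ 1 q + θ) + Real.cos (phase ℓ 2 q + θ) =
      Real.cos (phase ℓ 0 p + θ) + Real.cos (phase ℓ 1 p + θ) + Real.cos (phase ℓ 2 p + θ)) :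
    p = q := by
  have hcos := h 0
  have hsin := h (Real.pi / 2)
  simp only [add_zero] at hcos
  simp only [Real.cos_add_pi_div_two] at hsin
  have hperm := perm_of_sum_cos_sin_eq (phase_sum ℓ p) (phase_sum ℓ q) hcos (by linarith)
  rw [mem_triangle_iff hℓ] at hp hq
  have p0 := hp 0
  have p1 := hp 1
  have p2 := hp 2
  have q0 := hq 0
  have q1 := hq 1
  have q2 := hq 2
  have sp := bary_zero_eq ℓ p
  have sq := bary_zero_eq ℓ q
  have hπ := Real.pi_pos
  suffices hs : bary ℓ 0 p = bary ℓ 0 q ∧ bary ℓ 1 p = bary ℓ 1 q from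
    bary_ext hℓ hs.2 (by linarith [hs.1, hs.2])
  simp only [phase_zero, phase_one, phase_two] at hperm
  generalize bary ℓ 0 p = x at *
  generalize bary ℓ 1 p = y at *
  generalize bary ℓ 2 p = z at *
  generalize bary ℓ 0 q = x' at *
  generalize bary ℓ 1 q = y' at *
  generalize bary ℓ 2 q = z' at *
  -- The phases are at most `4π/3` in absolute value, so the integers are at most `1`.
  have cancel : ∀ (s t : ℝ) (k : ℤ), 2 * Real.pi / 3 * s = 2 * Real.pi / 3 * t + k * (2 * Real.pi) →
      s = t + 3 * k := fun s t k hk => by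
    have : 2 * Real.pi / 3 * (s - (t + 3 * k)) = 0 := by linear_combination hk
    have := (mul_eq_zero.1 this).resolve_left (by positivity)
    linarith
  have bound : ∀ (s t : ℝ) (k : ℤ), s = t + 3 * k → |s| ≤ 2 → |t| ≤ 2 → -1 ≤ k ∧ k ≤ 1 := by
    intro s t k hk hs ht
    rw [abs_le] at hs ht
    have h1 : (-2 : ℝ) < k := by linarith
    have h2 : (k : ℝ) < 2 := by linarith
    have h1' : -2 < k := by exact_mod_cast h1
    have h2' : k < 2 := by exact_mod_cast h2
    omega
  have hA : ∀ x y z : ℝ, 0 ≤ x → 0 ≤ y → 0 ≤ z → x = 1 - y - z →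
      |2 * x + y| ≤ 2 ∧ |y - x| ≤ 2 ∧ |-(x + 2 * y)| ≤ 2 := fun x y z h1 h2 h3 h4 =>
    ⟨abs_le.2 ⟨by linarith, by linarith⟩, abs_le.2 ⟨by linarith, by linarith⟩,
      abs_le.2 ⟨by linarith, by linarith⟩⟩
  obtain ⟨a1, a2, a3⟩ := hA x y z p0 p1 p2 sp
  obtain ⟨b1, b2, -⟩ := hA x' y' z' q0 q1 q2 sq
  have solve : ∀ u v : ℝ, |u| ≤ 2 → |v| ≤ 2 →
      (∃ k : ℤ, 2 * Real.pi / 3 * (2 * x' + y') = 2 * Real.pi / 3 * u + k * (2 * Real.pi)) →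
      (∃ k : ℤ, 2 * Real.pi / 3 * (y' - x') = 2 * Real.pi / 3 * v + k * (2 * Real.pi)) →
      ∃ i j : ℤ, 2 * x' + y' = u + 3 * i ∧ y' - x' = v + 3 * j ∧
        (-1 ≤ i ∧ i ≤ 1) ∧ (-1 ≤ j ∧ j ≤ 1) := by
    rintro u v hu hv ⟨i, hi⟩ ⟨j, hj⟩
    have hi := cancel _ _ _ hi
    have hj := cancel _ _ _ hj
    exact ⟨i, j, hi, hj, bound _ _ _ hi b1 hu, bound _ _ _ hj b2 hv⟩
  simp only [← mul_neg] at hperm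
  rcases hperm with ⟨r1, r2 | r2⟩ | ⟨r1, r2 | r2⟩ | ⟨r1, r2 | r2⟩ <;>
    obtain ⟨i, j, hi, hj, ⟨i1, i2⟩, ⟨j1, j2⟩⟩ := solve _ _ (by assumption) (by assumption) r1 r2 <;>
    interval_cases i <;> interval_cases j <;> norm_num at hi hj <;>
    exact ⟨by linarith, by linarith⟩

/-! ### Completeness of the eigenfunctions -/

attribute [local instance] Measure.Subtype.measureSpace

instance (ℓ : ℝ) : CompactSpace (triangle ℓ) := isCompact_iff_compactSpace.1 (isCompact_triangle ℓ)

instance (ℓ : ℝ) : IsFiniteMeasure (volume : Measure (triangle ℓ)) :=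
  ⟨by
    rw [Measure.Subtype.volume_univ (isClosed_triangle ℓ).nullMeasurableSet]
    exact (isCompact_triangle ℓ).measure_lt_top⟩

theorem dense_preimage_interior_triangle {ℓ : ℝ} (hℓ : ℓ ≠ 0) :
    Dense {p : triangle ℓ | (p : Plane) ∈ interior (triangle ℓ)} := by
  intro p
  rw [closure_subtype]
  have h : ((↑) : triangle ℓ → Plane) '' {p | (p : Plane) ∈ interior (triangle ℓ)} =
      interior (triangle ℓ) := by
    ext q
    exact ⟨fun ⟨r, hr, e⟩ => e ▸ hr, fun hq => ⟨⟨q, interior_subset hq⟩, hq, rfl⟩⟩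
  rw [h]
  exact triangle_subset_closure_interior hℓ p.2

theorem isOpenPosMeasure_triangle {ℓ : ℝ} (hℓ : ℓ ≠ 0) :
    (volume : Measure (triangle ℓ)).IsOpenPosMeasure := by
  refine ⟨fun U hU hne => ?_⟩
  obtain ⟨O, hO, rfl⟩ := isOpen_induced_iff.1 hU
  obtain ⟨p, hpO, hp⟩ := (dense_preimage_interior_triangle hℓ).inter_open_nonempty _ hU hne
  have hpos : 0 < volume (O ∩ interior (triangle ℓ)) :=
    (hO.inter isOpen_interior).measure_pos volume ⟨p, hpO, hp⟩
  have hms : MeasurableSet (triangle ℓ) := (isClosed_triangle ℓ).measurableSet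
  rw [Measure.Subtype.volume_def, comap_subtype_coe_apply hms, Subtype.image_preimage_coe]
  have hsub : O ∩ interior (triangle ℓ) ⊆ triangle ℓ ∩ O := fun q hq =>
    ⟨interior_subset hq.2, hq.1⟩
  exact (hpos.trans_le (measure_mono hsub)).ne'

/-- The restriction of an eigenfunction to the triangle. -/
def eigenfunOn (ℓ : ℝ) (m n : ℤ) (φ : ℝ) : C(triangle ℓ, ℝ) :=
  ⟨fun p => eigenfun ℓ m n φ p,
    (isHelmholtz_eigenfun ℓ m n φ).1.continuous.comp continuous_subtype_val⟩

theorem continuous_phase (ℓ : ℝ) (i : Fin 3) : Continuous (phase ℓ i) := by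
  have h0 := continuous_bary ℓ 0
  have h1 := continuous_bary ℓ 1
  fin_cases i
  · change Continuous fun p => 2 * Real.pi / 3 * (2 * bary ℓ 0 p + bary ℓ 1 p)
    fun_prop
  · change Continuous fun p => 2 * Real.pi / 3 * (bary ℓ 1 p - bary ℓ 0 p)
    fun_prop
  · change Continuous fun p => -(2 * Real.pi / 3 * (bary ℓ 0 p + 2 * bary ℓ 1 p))
    fun_prop

/-- The function `cos (A + θ) + cos (B + θ) + cos (C + θ)` of the phases on the triangle. -/
def invariantOn (ℓ θ : ℝ) : C(triangle ℓ, ℝ) :=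
  ⟨fun p => Real.cos (phase ℓ 0 p + θ) + Real.cos (phase ℓ 1 p + θ) + Real.cos (phase ℓ 2 p + θ), by
    have h := fun i => (continuous_phase ℓ i).comp (continuous_subtype_val (p := (· ∈ triangle ℓ)))
    have h0 : Continuous fun p : triangle ℓ => phase ℓ 0 p := h 0
    have h1 : Continuous fun p : triangle ℓ => phase ℓ 1 p := h 1
    have h2 : Continuous fun p : triangle ℓ => phase ℓ 2 p := h 2
    fun_prop⟩

theorem invariantOn_mul_eigenfunOn (ℓ θ : ℝ) (m n : ℤ) (φ : ℝ) :
    invariantOn ℓ θ * eigenfunOn ℓ m n φ = (1 / 2 : ℝ) •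
      (eigenfunOn ℓ (m + 1) n (φ + θ) + eigenfunOn ℓ (m - 1) n (φ - θ) +
        eigenfunOn ℓ m (n + 1) (φ + θ) + eigenfunOn ℓ m (n - 1) (φ - θ) +
        eigenfunOn ℓ (m - 1) (n - 1) (φ + θ) + eigenfunOn ℓ (m + 1) (n + 1) (φ - θ)) := by
  ext p
  exact sum_cos_mul_altCos m n φ θ _ _ _ (phase_sum ℓ p)

theorem eigenfun_two_one_ne_zero {ℓ : ℝ} (hℓ : ℓ ≠ 0) {p : Plane}
    (hp : p ∈ interior (triangle ℓ)) : eigenfun ℓ 2 1 (Real.pi / 2) p ≠ 0 := by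
  rw [interior_triangle hℓ] at hp
  have p0 := hp 0
  have p1 := hp 1
  have p2 := hp 2
  have hs := bary_zero_eq ℓ p
  have hπ := Real.pi_pos
  have hsin : ∀ t : ℝ, 0 < t → t < 1 → Real.sin (Real.pi * t) ≠ 0 := fun t h0 h1 =>
    (Real.sin_pos_of_pos_of_lt_pi (by positivity) (by nlinarith)).ne'
  rw [eigenfun, altCos_two_one (phase_sum ℓ p)]
  have e1 : (phase ℓ 0 p - phase ℓ 1 p) / 2 = Real.pi * bary ℓ 0 p := by
    rw [phase_zero, phase_one]; ring
  have e2 : (phase ℓ 1 p - phase ℓ 2 p) / 2 = Real.pi * bary ℓ 1 p := by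
    rw [phase_one, phase_two]; ring
  have e3 : (phase ℓ 0 p - phase ℓ 2 p) / 2 = Real.pi * (bary ℓ 0 p + bary ℓ 1 p) := by
    rw [phase_zero, phase_two]; ring
  rw [e1, e2, e3]
  exact mul_ne_zero (mul_ne_zero (mul_ne_zero (by norm_num) (hsin _ p0 (by linarith)))
    (hsin _ p1 (by linarith))) (hsin _ (by linarith) (by linarith))

theorem eq_zero_of_forall_integral_mul_eigenfunOn {ℓ : ℝ} (hℓ : ℓ ≠ 0) {u : C(triangle ℓ, ℝ)}
    (hu : ∀ m n φ, ∫ p, u p * eigenfunOn ℓ m n φ p = 0) : u = 0 := by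
  have := isOpenPosMeasure_triangle hℓ
  let Q : Submodule ℝ C(triangle ℓ, ℝ) :=
    Submodule.span ℝ (Set.range fun k : ℤ × ℤ × ℝ => eigenfunOn ℓ k.1 k.2.1 k.2.2)
  have hQ : ∀ m n φ, eigenfunOn ℓ m n φ ∈ Q := fun m n φ =>
    Submodule.subset_span ⟨(m, n, φ), rfl⟩
  have hsep : (Algebra.adjoin ℝ (Set.range (invariantOn ℓ))).SeparatesPoints := by
    intro p q hpq
    by_contra hcon
    push Not at hcon
    refine hpq (Subtype.ext (eq_of_sum_cos_phase_eq hℓ p.2 q.2 fun θ => ?_))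
    exact (hcon _ ⟨invariantOn ℓ θ, Algebra.subset_adjoin ⟨θ, rfl⟩, rfl⟩).symm
  refine eq_zero_of_forall_integral_mul_eq_zero volume hsep (Q := Q) ?_ (hQ 2 1 (Real.pi / 2)) ?_ ?_
  · intro a ha
    induction ha using Algebra.adjoin_induction with
    | mem a ha =>
      obtain ⟨θ, rfl⟩ := ha
      intro q hq
      induction hq using Submodule.span_induction with
      | mem q hq =>
        obtain ⟨⟨m, n, φ⟩, rfl⟩ := hq
        rw [invariantOn_mul_eigenfunOn]
        exact Q.smul_mem _ (Q.add_mem (Q.add_mem (Q.add_mem (Q.add_mem (Q.add_mem (hQ _ _ _)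
          (hQ _ _ _)) (hQ _ _ _)) (hQ _ _ _)) (hQ _ _ _)) (hQ _ _ _))
      | zero => rw [mul_zero]; exact Q.zero_mem
      | add q r _ _ hq hr => rw [mul_add]; exact Q.add_mem hq hr
      | smul c q _ hq => rw [mul_smul_comm]; exact Q.smul_mem c hq
    | algebraMap c =>
      intro q hq
      rw [← Algebra.smul_def]
      exact Q.smul_mem c hq
    | add a b _ _ ha hb =>
      intro q hq
      rw [add_mul]
      exact Q.add_mem (ha q hq) (hb q hq)
    | mul a b _ _ ha hb =>
      intro q hq
      rw [mul_assoc]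
      exact ha _ (hb q hq)
  · exact (dense_preimage_interior_triangle hℓ).mono fun p hp => eigenfun_two_one_ne_zero hℓ hp
  · intro q hq
    induction hq using Submodule.span_induction with
    | mem q hq =>
      obtain ⟨⟨m, n, φ⟩, rfl⟩ := hq
      exact hu m n φ
    | zero => simp
    | add q r _ _ hq hr =>
      have h := integral_add (integrable_continuousMap_mul volume u q)
        (integrable_continuousMap_mul volume u r)
      rw [hq, hr, add_zero] at h
      rw [← h]
      simp [mul_add]
    | smul c q _ hq =>
      have h := integral_const_mul (μ := volume) c fun p : triangle ℓ => u p * q p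
      rw [hq, mul_zero] at h
      rw [← h]
      simp [mul_left_comm]

/-! ### Dirichlet solutions are trigonometric polynomials -/

theorem IsHelmholtz.isDirichletSolution {ℓ κ : ℝ} (hℓ : ℓ ≠ 0) {F : Plane → ℝ}
    (hF : IsHelmholtz κ F) (hodd : IsOdd ℓ F) : IsDirichletSolution ℓ κ F where
  contDiffOn := (contDiff_infty.1 hF.1 2).contDiffOn
  continuousOn := hF.1.continuous.continuousOn
  boundary p hp := by
    obtain ⟨i, hi⟩ := ((mem_frontier_triangle_iff hℓ).1 hp).2
    exact hodd.eq_zero_of_bary_eq_zero hℓ hi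
  helmholtz p _ := hF.2 p

/-- The eigenfunctions with a given eigenvalue span a finite-dimensional space of functions on
the triangle, all of which extend to odd solutions on the plane. -/
theorem exists_eigenspace {ℓ : ℝ} (hℓ : ℓ ≠ 0) (κ : ℝ) :
    ∃ V : Submodule ℝ C(triangle ℓ, ℝ), FiniteDimensional ℝ V ∧
      (∀ m n φ, eigenval ℓ m n = κ → eigenfunOn ℓ m n φ ∈ V) ∧
      ∀ v ∈ V, ∃ F, IsOdd ℓ F ∧ IsHelmholtz κ F ∧ ∀ p : triangle ℓ, F p = v p := by
  let s : Set C(triangle ℓ, ℝ) := (fun k : (ℤ × ℤ) × ℝ => eigenfunOn ℓ k.1.1 k.1.2 k.2) ''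
    ({mn : ℤ × ℤ | eigenval ℓ mn.1 mn.2 = κ} ×ˢ {0, Real.pi / 2})
  have hs : s.Finite := ((finite_eigenval_eq hℓ κ).prod (Set.toFinite _)).image _
  refine ⟨Submodule.span ℝ s, FiniteDimensional.span_of_finite ℝ hs, fun m n φ h => ?_,
    fun v hv => ?_⟩
  · have he : eigenfunOn ℓ m n φ = Real.cos φ • eigenfunOn ℓ m n 0 +
        Real.sin φ • eigenfunOn ℓ m n (Real.pi / 2) := by
      ext p
      exact altCos_add_phase m n φ _ _ _
    rw [he]
    exact Submodule.add_mem _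
      (Submodule.smul_mem _ _ (Submodule.subset_span ⟨((m, n), 0), ⟨h, by simp⟩, rfl⟩))
      (Submodule.smul_mem _ _ (Submodule.subset_span ⟨((m, n), Real.pi / 2), ⟨h, by simp⟩, rfl⟩))
  · induction hv using Submodule.span_induction with
    | mem v hv =>
      obtain ⟨⟨⟨m, n⟩, φ⟩, ⟨h, -⟩, rfl⟩ := hv
      have h : eigenval ℓ m n = κ := h
      exact ⟨eigenfun ℓ m n φ, isOdd_eigenfun hℓ m n φ, h ▸ isHelmholtz_eigenfun ℓ m n φ,
        fun p => rfl⟩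
    | zero => exact ⟨0, fun i p => by simp, isHelmholtz_zero κ, fun p => rfl⟩
    | add v w _ _ hv hw =>
      obtain ⟨F, h1, h2, h3⟩ := hv
      obtain ⟨G, k1, k2, k3⟩ := hw
      refine ⟨F + G, fun i p => ?_, h2.add k2, fun p => by simp [h3, k3]⟩
      simp only [Pi.add_apply, h1 i p, k1 i p]
      ring
    | smul c v _ hv =>
      obtain ⟨F, h1, h2, h3⟩ := hv
      exact ⟨c • F, fun i p => by simp [h1 i p], h2.smul c, fun p => by simp [h3]⟩

theorem IsDirichletSolution.exists_isOdd_isHelmholtz {ℓ κ : ℝ} (hℓ : ℓ ≠ 0) {f : Plane → ℝ}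
    (hf : IsDirichletSolution ℓ κ f) :
    ∃ F, IsOdd ℓ F ∧ IsHelmholtz κ F ∧ Set.EqOn F f (triangle ℓ) := by
  have := isOpenPosMeasure_triangle hℓ
  obtain ⟨V, hfin, hV, hext⟩ := exists_eigenspace hℓ κ
  let f' : C(triangle ℓ, ℝ) := ⟨fun p => f p, hf.continuousOn.domRestrict⟩
  obtain ⟨v, hvV, hv⟩ := exists_mem_forall_integral_sub_mul_eq_zero volume V f'
  obtain ⟨F, hodd, hF, hFv⟩ := hext v hvV
  have hms : MeasurableSet (triangle ℓ) := (isClosed_triangle ℓ).measurableSet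
  have hzero : f' - v = 0 := by
    refine eq_zero_of_forall_integral_mul_eigenfunOn hℓ fun m n φ => ?_
    by_cases hval : eigenval ℓ m n = κ
    · exact hv _ (hV m n φ hval)
    · have hboundary : ∀ p ∈ frontier (triangle ℓ), eigenfun ℓ m n φ p = 0 :=
        ((isHelmholtz_eigenfun ℓ m n φ).isDirichletSolution hℓ (isOdd_eigenfun hℓ m n φ)).boundary
      have horth : ∀ {g : Plane → ℝ}, IsDirichletSolution ℓ κ g →
          ∫ p : triangle ℓ, g p * eigenfun ℓ m n φ p = 0 := fun hg =>
        (integral_subtype_comap hms _).trans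
          (hg.integral_mul_eq_zero hℓ (isHelmholtz_eigenfun ℓ m n φ) hboundary hval)
      have h1 : ∫ p, f' p * eigenfunOn ℓ m n φ p = 0 := horth hf
      have h2 : ∫ p, v p * eigenfunOn ℓ m n φ p = 0 := by
        rw [← horth (hF.isDirichletSolution hℓ hodd)]
        exact integral_congr_ae (ae_of_all _ fun p => congrArg (· * _) (hFv p).symm)
      have h := integral_sub (integrable_continuousMap_mul volume f' (eigenfunOn ℓ m n φ))
        (integrable_continuousMap_mul volume v (eigenfunOn ℓ m n φ))
      rw [h1, h2, sub_zero] at h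
      rw [← h]
      simp [sub_mul]
  refine ⟨F, hodd, hF, fun p hp => ?_⟩
  have h : f p - v ⟨p, hp⟩ = 0 := DFunLike.congr_fun hzero ⟨p, hp⟩
  rw [hFv ⟨p, hp⟩]
  linarith

theorem IsHelmholtz.harmonic {ℓ κ : ℝ} {F : Plane → ℝ} (hF : IsHelmholtz κ F) (n : ℕ) :
    IsHelmholtz ((n : ℝ) ^ 2 * κ) (TriangleHelmholtz.harmonic ℓ n F) := by
  have he : TriangleHelmholtz.harmonic ℓ n F =
      fun p => F ((n : ℝ) • p + (1 - n : ℝ) • vertex ℓ 0) :=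
    funext fun p => congrArg F (dilation_eq ℓ n p)
  rw [he]
  refine ⟨hF.1.comp ((contDiff_const_smul _).add contDiff_const), fun p => ?_⟩
  rw [laplacian_comp_smul_add]
  linear_combination (n : ℝ) ^ 2 * hF.2 ((n : ℝ) • p + (1 - n : ℝ) • vertex ℓ 0)

theorem nontriv_harmonic {ℓ : ℝ} (hℓ : ℓ ≠ 0) {f F : Plane → ℝ}
    (h : Set.EqOn F f (triangle ℓ)) {n : ℕ} (hn : 1 ≤ n) (hf : Nontriv ℓ f) :
    Nontriv ℓ (harmonic ℓ n F) := by
  obtain ⟨p, hp, hfp⟩ := hf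
  have hn1 : (1 : ℝ) ≤ n := by exact_mod_cast hn
  -- The preimage of `p` under the dilation, which is `p` moved towards vertex `0`.
  refine ⟨ofBary ℓ (bary ℓ 1 p / n) (bary ℓ 2 p / n), ?_, ?_⟩
  · rw [triangle_eq_cell hℓ] at hp ⊢
    simp only [cell, Set.mem_ofPred_eq, bary_one_ofBary hℓ, bary_two_ofBary hℓ, Int.cast_one,
      Int.cast_zero, sub_zero, one_mul] at hp ⊢
    obtain ⟨h1, h2, h3⟩ := hp
    refine ⟨by positivity, by positivity, ?_⟩
    rw [← add_div, div_le_one (by linarith)]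
    linarith
  · rw [harmonic_ofBary hℓ, mul_div_cancel₀ _ (by positivity), mul_div_cancel₀ _ (by positivity),
      ofBary_bary hℓ, h hp]
    exact hfp

end TriangleHelmholtz

theorem mainTheorem4 (ℓ : ℝ) (hℓ : ℓ ≠ 0) (k : ℝ) (f : TriangleHelmholtz.Plane → ℝ)
    (hf : TriangleHelmholtz.IsDirichletSolution ℓ (k ^ 2) f) :
    ∃ F : TriangleHelmholtz.Plane → ℝ,
      -- the tessellation of the plane by `f` exists, is unique, and is a smooth solution
      TriangleHelmholtz.IsTessellation ℓ f F ∧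
      (∀ F', TriangleHelmholtz.IsTessellation ℓ f F' → F' = F) ∧
      ContDiff ℝ ∞ F ∧
      (∀ p, Laplacian.laplacian F p + k ^ 2 * F p = 0) ∧
      -- its harmonics
      ∀ n : ℕ, 1 ≤ n →
        TriangleHelmholtz.IsDirichletSolution ℓ ((n : ℝ) ^ 2 * k ^ 2)
          (TriangleHelmholtz.harmonic ℓ n F) ∧
        (TriangleHelmholtz.Nontriv ℓ f →
          TriangleHelmholtz.Nontriv ℓ (TriangleHelmholtz.harmonic ℓ n F)) ∧
        (∃ W : Fin (n ^ 2) → List (Fin 3), TriangleHelmholtz.IsReflectedDecomposition ℓ n f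
          (TriangleHelmholtz.harmonic ℓ n F) W) ∧
        (TriangleHelmholtz.RotSymmetric ℓ f →
          TriangleHelmholtz.RotSymmetric ℓ (TriangleHelmholtz.harmonic ℓ n F)) ∧
        (TriangleHelmholtz.ClassA1 ℓ (k ^ 2) f →
          TriangleHelmholtz.ClassA1 ℓ ((n : ℝ) ^ 2 * k ^ 2)
            (TriangleHelmholtz.harmonic ℓ n F)) ∧
        (TriangleHelmholtz.ClassA2 ℓ (k ^ 2) f →
          TriangleHelmholtz.ClassA2 ℓ ((n : ℝ) ^ 2 * k ^ 2)
            (TriangleHelmholtz.harmonic ℓ n F)) ∧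
        (TriangleHelmholtz.ClassE2 ℓ (k ^ 2) f →
          (TriangleHelmholtz.ClassA2 ℓ ((n : ℝ) ^ 2 * k ^ 2)
            (TriangleHelmholtz.harmonic ℓ n F) ↔ 3 ∣ n)) := by
  open TriangleHelmholtz in
  obtain ⟨F, hodd, hF, hFf⟩ := hf.exists_isOdd_isHelmholtz hℓ
  refine ⟨F, ⟨hFf, hodd⟩, ?_, hF.1, hF.2, fun n hn => ?_⟩
  · rintro F' ⟨hF'f, hodd'⟩
    exact IsOdd.eq_of_eqOn hℓ hodd' hodd (hF'f.trans hFf.symm)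
  · have hH : IsDirichletSolution ℓ ((n : ℝ) ^ 2 * k ^ 2) (harmonic ℓ n F) :=
      (hF.harmonic n).isDirichletSolution hℓ (hodd.harmonic hℓ n)
    have hrot := rotSymmetric_congr hℓ hFf
    have hrefl := reflSymmetric_congr hℓ hFf
    have hanti := reflAntisymmetric_congr hℓ hFf
    refine ⟨hH, nontriv_harmonic hℓ hFf hn, exists_isReflectedDecomposition hℓ hodd hFf hn,
      fun h => hodd.rotSymmetric_harmonic hℓ hn (hrot.2 h), ?_, ?_, ?_⟩
    · rintro ⟨-, h1, h2⟩
      exact ⟨hH, hodd.rotSymmetric_harmonic hℓ hn (hrot.2 h1),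
        hodd.reflSymmetric_harmonic hℓ n (hrefl.2 h2)⟩
    · rintro ⟨-, h1, h2⟩
      exact ⟨hH, hodd.rotSymmetric_harmonic hℓ hn (hrot.2 h1),
        hodd.reflAntisymmetric_harmonic hℓ n (hanti.2 h2)⟩
    · rintro ⟨-, ⟨h1, -⟩, h2⟩
      have hiff := hodd.rotSymmetric_harmonic_iff_three_dvd hℓ hn fun h => h1 (hrot.1 h)
      exact ⟨fun h => hiff.1 h.2.1,
        fun h => ⟨hH, hiff.2 h, hodd.reflAntisymmetric_harmonic hℓ n (hanti.2 h2)⟩⟩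

end
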